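/- Proposition 6.1 (prop-6.1). Fix any $\sigma\in(0,1/10)$ and let $X_0,X_1,\dots$ be a random walk with step distribution $\mathcal N(0,1/2)$ (independent, centred normal increments of variance $1/2$). For each $\epsilon\in(0,1)$ and each $\delta\in(0,1)$ there exists $a_0\ge 1$, depending only on $\sigma$, $\epsilon$ and $\delta$, such that for all real $a\ge a_0$, all naturals $k\ge 2$, all reals $r,u$ satisfying $$r,u\ge a^{1/\sigma}\quad\text{and}\quad ru\le k^{1-\delta},$$ and all $\gamma\colon\{0,\dots,k\}\to\mathbb R$ obeying $$|\gamma(i)|\le a+\bigl(\min\{i,k-i\}\bigr)^{\sigma},\qquad i=0,\dots,k,$$ we have $$(1-\epsilon)\frac{4ru}{k}\le P\bigl(X_j\ge\gamma(j)\text{ for all }j=1,\dots,k-1\,\big|\,X_0=r,\,X_k=u\bigr)\le(1+\epsilon)\frac{4ru}{k}.$$ Here the conditional law of $(X_1,\dots,X_{k-1})$ given $X_0=r$ and $X_k=u$ is the one given by the conditional density, i.e. it has Lebesgue density proportional to $\prod_{j=1}^{k}\varphi(x_j-x_{j-1})$ with $x_0:=r$, $x_k:=u$ and $\varphi$ the density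 of $\mathcal N(0,1/2)$. -/

import Mathlib

open MeasureTheory ProbabilityTheory
open scoped ENNReal NNReal

noncomputable section

/-- The law on `ℝⁿ` of the positions `(X₁, …, Xₙ)` of the random walk started at `X₀ = r` whose
steps are i.i.d. centred normal with variance `1/2`:  `X_{i+1} = r + y₀ + ⋯ + yᵢ`. -/
def walkLaw (n : ℕ) (r : ℝ) : Measure (Fin n → ℝ) :=
  (Measure.pi fun _ : Fin n => gaussianReal 0 (1 / 2)).map
    (fun y i => r + ∑ j ∈ Finset.Iic i, y j)

/-- The joint probability density of the positions `(X₁, …, Xₙ)` of that walk, i.e. the product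
over the steps of the `N(0,1/2)`-density evaluated at the increments of `(r, x₀, …, xₙ₋₁)`.
The lemma `walkLaw_eq_withDensity` below shows that it is the density of `walkLaw n r`. -/
def walkDensity (n : ℕ) (r : ℝ) (x : Fin n → ℝ) : ℝ≥0∞ :=
  ∏ i : Fin n, gaussianPDF 0 (1 / 2) (x i - (Fin.cons r x : Fin (n + 1) → ℝ) i.castSucc)

/-- Joint density of `(X₁, …, X_m, X_{m+1})` with the last coordinate frozen at `u`, as a
(not normalised) measure in the variables `(X₁, …, X_m)`. Its total mass is the density at `u`
of `X_{m+1}`. -/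
def bridgeUnnorm (m : ℕ) (r u : ℝ) : Measure (Fin m → ℝ) :=
  volume.withDensity fun x =>
    walkDensity (m + 1) r (Fin.snoc x u : Fin (m + 1) → ℝ)

/-- The law of `(X₁, …, X_m)` conditional on `X₀ = r` and `X_{m+1} = u`, given by the usual
conditional density (joint density divided by the marginal density at `u` of `X_{m+1}`).
The facts below show that it is a probability measure for all `r, u` and that it is
a regular conditional distribution of `(X₁, …, X_m)` given `X_{m+1}`. -/
def bridgeLaw (m : ℕ) (r u : ℝ) : Measure (Fin m → ℝ) :=
  (bridgeUnnorm m r u Set.univ)⁻¹ • bridgeUnnorm m r u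

theorem lintegral_pi_cons (n : ℕ) (μ : Measure ℝ) [SigmaFinite μ]
    (g : (Fin (n + 1) → ℝ) → ℝ≥0∞) (hg : Measurable g) :
    ∫⁻ x, g x ∂(Measure.pi fun _ : Fin (n + 1) => μ)
      = ∫⁻ t, ∫⁻ y, g (Fin.cons t y : Fin (n + 1) → ℝ) ∂(Measure.pi fun _ : Fin n => μ) ∂μ := by
  have h := (measurePreserving_piFinSuccAbove (fun _ : Fin (n + 1) => μ) 0).symm
  rw [← h.lintegral_comp hg]
  refine (lintegral_prod _ (hg.comp h.measurable).aemeasurable).trans ?_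
  simp [MeasurableEquiv.piFinSuccAbove, Fin.insertNthEquiv]

theorem lintegral_pi_snoc (n : ℕ) (μ : Measure ℝ) [SigmaFinite μ]
    (g : (Fin (n + 1) → ℝ) → ℝ≥0∞) (hg : Measurable g) :
    ∫⁻ x, g x ∂(Measure.pi fun _ : Fin (n + 1) => μ)
      = ∫⁻ t, ∫⁻ y, g (Fin.snoc y t : Fin (n + 1) → ℝ) ∂(Measure.pi fun _ : Fin n => μ) ∂μ := by
  have h := (measurePreserving_piFinSuccAbove (fun _ : Fin (n + 1) => μ) (Fin.last n)).symm
  rw [← h.lintegral_comp hg]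
  refine (lintegral_prod _ (hg.comp h.measurable).aemeasurable).trans ?_
  simp [MeasurableEquiv.piFinSuccAbove, Fin.insertNthEquiv, Fin.insertNth_last']

theorem measurable_cons_fst (n : ℕ) (r : ℝ) :
    Measurable fun x : Fin n → ℝ => (Fin.cons r x : Fin (n + 1) → ℝ) := by
  refine measurable_pi_iff.2 fun i => ?_
  refine Fin.cases ?_ (fun j => ?_) i
  · simp
  · simpa using measurable_pi_apply j

theorem measurable_walkDensity (n : ℕ) (r : ℝ) : Measurable (walkDensity n r) := by
  unfold walkDensity
  refine Finset.measurable_prod _ fun i _ => ?_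
  exact (measurable_gaussianPDF 0 (1 / 2)).comp
    ((measurable_pi_apply i).sub ((measurable_pi_apply _).comp (measurable_cons_fst n r)))

theorem walkDensity_cons (n : ℕ) (r t : ℝ) (x : Fin n → ℝ) :
    walkDensity (n + 1) r (Fin.cons t x : Fin (n + 1) → ℝ)
      = gaussianPDF 0 (1 / 2) (t - r) * walkDensity n t x := by
  unfold walkDensity
  rw [Fin.prod_univ_succ]
  simp

theorem measurable_positions (n : ℕ) (r : ℝ) :
    Measurable fun (y : Fin n → ℝ) (i : Fin n) => r + ∑ j ∈ Finset.Iic i, y j := by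
  fun_prop

theorem positions_cons (n : ℕ) (r t : ℝ) (y : Fin n → ℝ) :
    (fun i : Fin (n + 1) => r + ∑ j ∈ Finset.Iic i, (Fin.cons t y : Fin (n + 1) → ℝ) j)
      = (Fin.cons (r + t) (fun i : Fin n => (r + t) + ∑ j ∈ Finset.Iic i, y j) :
          Fin (n + 1) → ℝ) := by
  have key : ∀ i : Fin (n + 1), ∑ j ∈ Finset.Iic i, (Fin.cons t y : Fin (n + 1) → ℝ) j
      = t + ∑ j : Fin n, if j.succ ≤ i then y j else 0 := by
    intro i
    have : Finset.Iic i = Finset.univ.filter (fun j => j ≤ i) := by ext; simp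
    rw [this, Finset.sum_filter, Fin.sum_univ_succ]
    simp
  funext i
  rw [key]
  refine Fin.cases ?_ (fun j => ?_) i
  · simp [Fin.succ_ne_zero]
  · have : Finset.Iic j = Finset.univ.filter (fun l => l ≤ j) := by ext; simp
    simp [this, Finset.sum_filter, add_assoc]

theorem lintegral_walk (n : ℕ) : ∀ (r : ℝ) (f : (Fin n → ℝ) → ℝ≥0∞), Measurable f →
    ∫⁻ y, f (fun i => r + ∑ j ∈ Finset.Iic i, y j)
        ∂(Measure.pi fun _ : Fin n => gaussianReal 0 (1 / 2))
      = ∫⁻ x, walkDensity n r x * f x := by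
  induction n with
  | zero =>
    intro r f hf
    rw [volume_pi, Measure.pi_of_empty _ 0, Measure.pi_of_empty _ 0]
    refine (lintegral_dirac' _ (hf.comp (measurable_positions 0 r))).trans
      (Eq.trans ?_ (lintegral_dirac' _ ((measurable_walkDensity 0 r).mul hf)).symm)
    simp only [Function.comp, Pi.mul_apply]
    simp only [walkDensity, Finset.univ_eq_empty, Finset.prod_empty, one_mul]
    congr 1
    exact Subsingleton.elim _ _
  | succ n ih =>
    intro r f hf
    have hv : ((1 : ℝ≥0) / 2) ≠ 0 := by positivity
    rw [volume_pi]
    refine (lintegral_pi_cons n _ _ (hf.comp (measurable_positions (n + 1) r))).trans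
      (Eq.trans ?_ (lintegral_pi_cons n _ _ ((measurable_walkDensity (n + 1) r).mul hf)).symm)
    simp only [Function.comp, Pi.mul_apply, positions_cons, walkDensity_cons]
    have h1 : ∀ t : ℝ, ∫⁻ y, f (Fin.cons (r + t) (fun i : Fin n =>
          (r + t) + ∑ j ∈ Finset.Iic i, y j) : Fin (n + 1) → ℝ)
          ∂(Measure.pi fun _ : Fin n => gaussianReal 0 (1 / 2))
        = ∫⁻ x, walkDensity n (r + t) x * f (Fin.cons (r + t) x : Fin (n + 1) → ℝ) := fun t =>
      ih (r + t) (fun x => f (Fin.cons (r + t) x : Fin (n + 1) → ℝ))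
        (hf.comp (measurable_cons_fst n (r + t)))
    simp_rw [h1]
    have hmeas : ∀ t : ℝ, Measurable fun x : Fin n → ℝ =>
        walkDensity n t x * f (Fin.cons t x : Fin (n + 1) → ℝ) := fun t =>
      (measurable_walkDensity n t).mul (hf.comp (measurable_cons_fst n t))
    rw [gaussianReal_of_var_ne_zero _ hv, lintegral_withDensity_eq_lintegral_mul_non_measurable _
      (measurable_gaussianPDF _ _) (by simp [gaussianPDF_lt_top])]
    have h2 := lintegral_sub_right_eq_self (μ := (volume : Measure ℝ))
      (fun t => gaussianPDF 0 (1 / 2) t *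
        ∫⁻ x, walkDensity n (r + t) x * f (Fin.cons (r + t) x : Fin (n + 1) → ℝ)) r
    simp only [Pi.mul_apply]
    rw [← h2]
    refine lintegral_congr fun t => ?_
    have ht : r + (t - r) = t := by ring
    rw [ht, ← lintegral_const_mul _ (hmeas t)]
    simp [mul_assoc, volume_pi]

theorem walkLaw_eq_withDensity (n : ℕ) (r : ℝ) :
    walkLaw n r = volume.withDensity (walkDensity n r) := by
  ext s hs
  rw [walkLaw, ← lintegral_indicator_one hs, lintegral_map (measurable_one.indicator hs)
    (measurable_positions n r), lintegral_walk n r _ (measurable_one.indicator hs),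
    withDensity_apply _ hs, ← lintegral_indicator hs]
  refine lintegral_congr fun x => ?_
  by_cases hx : x ∈ s <;> simp [hx]

instance isProbabilityMeasure_walkLaw (n : ℕ) (r : ℝ) : IsProbabilityMeasure (walkLaw n r) :=
  Measure.isProbabilityMeasure_map (measurable_positions n r).aemeasurable

theorem lintegral_walkDensity (n : ℕ) (r : ℝ) : ∫⁻ x, walkDensity n r x = 1 := by
  have h : walkLaw n r Set.univ = 1 := measure_univ
  rwa [walkLaw_eq_withDensity, withDensity_apply _ MeasurableSet.univ,
    Measure.restrict_univ] at h

theorem walkDensity_snoc (m : ℕ) (r u : ℝ) (x : Fin m → ℝ) :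
    walkDensity (m + 1) r (Fin.snoc x u : Fin (m + 1) → ℝ)
      = walkDensity m r x *
        gaussianPDF 0 (1 / 2) (u - (Fin.cons r x : Fin (m + 1) → ℝ) (Fin.last m)) := by
  unfold walkDensity
  rw [Fin.prod_univ_castSucc]
  have h : (Fin.cons r (Fin.snoc x u : Fin (m + 1) → ℝ) : Fin (m + 2) → ℝ)
      = (Fin.snoc (Fin.cons r x : Fin (m + 1) → ℝ) u : Fin (m + 2) → ℝ) :=
    Fin.cons_snoc_eq_snoc_cons r x u
  rw [h]
  simp

theorem measurable_snoc_fst (m : ℕ) :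
    Measurable fun p : (Fin m → ℝ) × ℝ => (Fin.snoc p.1 p.2 : Fin (m + 1) → ℝ) := by
  refine measurable_pi_iff.2 fun i => ?_
  refine Fin.lastCases ?_ (fun j => ?_) i
  · simpa using measurable_snd
  · simpa [Function.comp_def] using
      (measurable_pi_apply j).comp (measurable_fst (α := Fin m → ℝ) (β := ℝ))

theorem bridgeUnnorm_univ_ne_zero (m : ℕ) (r u : ℝ) : bridgeUnnorm m r u Set.univ ≠ 0 := by
  have hv : ((1 : ℝ≥0) / 2) ≠ 0 := by positivity
  rw [bridgeUnnorm, withDensity_apply _ MeasurableSet.univ, Measure.restrict_univ]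
  intro h
  have hm : Measurable fun x : Fin m → ℝ =>
      walkDensity (m + 1) r (Fin.snoc x u : Fin (m + 1) → ℝ) :=
    (measurable_walkDensity (m + 1) r).comp
      ((measurable_snoc_fst m).comp (measurable_id.prodMk measurable_const))
  rw [lintegral_eq_zero_iff hm] at h
  have h0 : ∀ᵐ _ : Fin m → ℝ, False := by
    filter_upwards [h] with x hx
    refine absurd hx (Finset.prod_ne_zero_iff.2 fun i _ => (gaussianPDF_pos _ hv _).ne')
  exact (NeZero.ne (volume : Measure (Fin m → ℝ)))
    (by simpa [Filter.eventually_false_iff_eq_bot] using h0)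

theorem bridgeUnnorm_univ_ne_top (m : ℕ) (r u : ℝ) : bridgeUnnorm m r u Set.univ ≠ ∞ := by
  rw [bridgeUnnorm, withDensity_apply _ MeasurableSet.univ, Measure.restrict_univ]
  have hC : ∀ z : ℝ, gaussianPDF 0 (1 / 2) z ≤ gaussianPDF 0 (1 / 2) 0 := by
    intro z
    refine ENNReal.ofReal_le_ofReal ?_
    unfold gaussianPDFReal
    gcongr ?_ * ?_
    refine Real.exp_le_exp.2 ?_
    simp
    positivity
  have : ∫⁻ x : Fin m → ℝ, walkDensity (m + 1) r (Fin.snoc x u : Fin (m + 1) → ℝ)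
      ≤ ∫⁻ x : Fin m → ℝ, walkDensity m r x * gaussianPDF 0 (1 / 2) 0 := by
    refine lintegral_mono fun x => ?_
    simp only [walkDensity_snoc]
    gcongr
    exact hC _
  rw [lintegral_mul_const _ (measurable_walkDensity m r), lintegral_walkDensity, one_mul] at this
  exact (this.trans_lt gaussianPDF_lt_top).ne

instance isProbabilityMeasure_bridgeLaw (m : ℕ) (r u : ℝ) :
    IsProbabilityMeasure (bridgeLaw m r u) := by
  constructor
  rw [bridgeLaw, Measure.smul_apply, smul_eq_mul]
  exact ENNReal.inv_mul_cancel (bridgeUnnorm_univ_ne_zero m r u) (bridgeUnnorm_univ_ne_top m r u)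

/-- `bridgeLaw m r` is a regular conditional distribution of `(X₁, …, X_m)` given `X_{m+1}` for
the walk started at `X₀ = r`: for Borel sets `A ⊆ ℝᵐ` and `B ⊆ ℝ`,
`P((X₁,…,X_m) ∈ A, X_{m+1} ∈ B) = E[1_{X_{m+1} ∈ B} · bridgeLaw m r X_{m+1} A]`. -/
theorem walkLaw_disintegration (m : ℕ) (r : ℝ) {A : Set (Fin m → ℝ)} {B : Set ℝ}
    (hA : MeasurableSet A) (hB : MeasurableSet B) :
    walkLaw (m + 1) r {x | Fin.init x ∈ A ∧ x (Fin.last m) ∈ B}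
      = ∫⁻ x in {x | x (Fin.last m) ∈ B}, bridgeLaw m r (x (Fin.last m)) A
          ∂(walkLaw (m + 1) r) := by
  have hinit : Measurable fun x : Fin (m + 1) → ℝ => (Fin.init x : Fin m → ℝ) :=
    measurable_pi_iff.2 fun i => measurable_pi_apply _
  have hlast : Measurable fun x : Fin (m + 1) → ℝ => x (Fin.last m) := measurable_pi_apply _
  have hS : MeasurableSet {x : Fin (m + 1) → ℝ | x (Fin.last m) ∈ B} := hlast hB
  have hT : MeasurableSet {x : Fin (m + 1) → ℝ | Fin.init x ∈ A ∧ x (Fin.last m) ∈ B} :=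
    (hinit hA).inter hS
  have hρ : Measurable fun p : ℝ × (Fin m → ℝ) =>
      walkDensity (m + 1) r (Fin.snoc p.2 p.1 : Fin (m + 1) → ℝ) :=
    (measurable_walkDensity (m + 1) r).comp ((measurable_snoc_fst m).comp measurable_swap)
  have hun : ∀ (S : Set (Fin m → ℝ)) (u : ℝ), MeasurableSet S → bridgeUnnorm m r u S
      = ∫⁻ x in S, walkDensity (m + 1) r (Fin.snoc x u : Fin (m + 1) → ℝ) := fun S u hSm => by
    rw [bridgeUnnorm, withDensity_apply _ hSm]
  have hunm : ∀ S : Set (Fin m → ℝ), MeasurableSet S →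
      Measurable fun u => bridgeUnnorm m r u S := fun S hSm => by
    simp_rw [hun S _ hSm]
    exact hρ.lintegral_prod_right'
  have hbm : Measurable fun u => bridgeLaw m r u A := by
    simp only [bridgeLaw, Measure.smul_apply, smul_eq_mul]
    exact (hunm _ MeasurableSet.univ).inv.mul (hunm _ hA)
  rw [walkLaw_eq_withDensity, withDensity_apply _ hT, ← lintegral_indicator hT,
    ← lintegral_indicator hS]
  refine Eq.trans ?_ (lintegral_withDensity_eq_lintegral_mul _
      (measurable_walkDensity (m + 1) r) ((hbm.comp hlast).indicator hS)).symm
  rw [volume_pi, lintegral_pi_snoc m _ _ ((measurable_walkDensity (m + 1) r).indicator hT),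
    lintegral_pi_snoc m _ _ ((measurable_walkDensity (m + 1) r).mul
      ((hbm.comp hlast).indicator hS))]
  refine lintegral_congr fun u => ?_
  by_cases hu : u ∈ B
  · have e1 : ∀ y : Fin m → ℝ, Set.indicator
        {x : Fin (m + 1) → ℝ | Fin.init x ∈ A ∧ x (Fin.last m) ∈ B} (walkDensity (m + 1) r)
        (Fin.snoc y u : Fin (m + 1) → ℝ)
        = A.indicator (fun y => walkDensity (m + 1) r (Fin.snoc y u : Fin (m + 1) → ℝ)) y := by
      intro y
      by_cases hy : y ∈ A <;> simp [Set.indicator, hy, hu]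
    have hm : Measurable fun y : Fin m → ℝ =>
        walkDensity (m + 1) r (Fin.snoc y u : Fin (m + 1) → ℝ) :=
      (measurable_walkDensity (m + 1) r).comp
        ((measurable_snoc_fst m).comp (measurable_id.prodMk measurable_const))
    have e2 : ∀ y : Fin m → ℝ, (walkDensity (m + 1) r * Set.indicator
        {x : Fin (m + 1) → ℝ | x (Fin.last m) ∈ B}
        ((fun v => bridgeLaw m r v A) ∘ fun x : Fin (m + 1) → ℝ => x (Fin.last m)))
        (Fin.snoc y u : Fin (m + 1) → ℝ)
        = walkDensity (m + 1) r (Fin.snoc y u : Fin (m + 1) → ℝ) * bridgeLaw m r u A := by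
      intro y
      have hmem : (Fin.snoc y u : Fin (m + 1) → ℝ) ∈
          {x : Fin (m + 1) → ℝ | x (Fin.last m) ∈ B} := by simpa using hu
      rw [Pi.mul_apply, Set.indicator_of_mem hmem, Function.comp_apply, Fin.snoc_last]
    rw [lintegral_congr e1, lintegral_congr e2, lintegral_indicator hA,
      lintegral_mul_const _ hm, ← volume_pi, ← hun A u hA]
    have h1 := hun Set.univ u MeasurableSet.univ
    rw [Measure.restrict_univ] at h1
    rw [← h1, bridgeLaw, Measure.smul_apply, smul_eq_mul, ← mul_assoc,
      ENNReal.mul_inv_cancel (bridgeUnnorm_univ_ne_zero m r u)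
        (bridgeUnnorm_univ_ne_top m r u), one_mul]
  · simp [Set.indicator, hu]

end

/-!
For Brownian motion of variance `1 / 2` per unit of time, the reflection principle gives the
probability `1 - exp (-4 (r - b) (u - b) / k)` for a bridge of duration `k` from `r` to `u` to stay
above a constant level `b`, and this is about `4 r u / k` when `b` is small compared to `r` and `u`
and `r u` is small compared to `k`. The proof transfers this to the walk and then shows that
replacing a constant level by the moving barrier changes the probability by a negligible amount.

*Constant level.* Let `F_t(x)` be the Brownian transition density to `u` killed at a level `c`, a
difference of two Gaussian densities (`killedHeat`). It solves the one-step Gaussian recursion on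
the whole line. With `c = b` it is negative below `b`, so that it is a subsolution of the recursion
of the walk restricted to `[b, ∞)` (`killedHeat_le_pathWeight`). With `c = b - s`, `s ≥ 5`, it is
positive on `[b - s, b]`, and this outweighs, after one step to a point above `b`, the negative
values below `b - s`, once the time is at least `u - c`
(`integral_Iio_killedHeat_nonneg`). So it is a supersolution, up to a factor
`(1 - exp (-2 s))⁻¹` which settles the shorter times (`pathWeight_le_killedHeat`). Both bounds are
uniform in the endpoints; with `s = 5` the second one also gives a bound of the right order for
endpoints near `b` (`pathWeight_le_mul`).

*Moving barrier.* Let `m` be the distance in time of `j` to the nearer endpoint and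
`c j = a + m ^ σ`. A path above `a` that violates the barrier at time `j` is in the window
`[a, c j]` at time `j`. A path above the barrier but not above `-a`, looked at the time `j` of its
minimum, is in the window `[-c j, -a]` and stays above the constant level `-c j`. By the Markov
property and `pathWeight_le_mul` on both sides of `j`, such an event has probability of order at
most `(r u / k) * m ^ (5 σ - 3 / 2)`, with an additional small factor since the window is out of
reach for `m` much smaller than `a ^ (2 / σ)`. As `5 σ < 1 / 2`, the sum over `j` is
`o(r u / k)` as `a → ∞` (`sum_bridgeLaw_windowEvent_le`).
-/

/-! ### Gaussian transition densities -/

/-- The density at `x` of a centred normal variable with variance `t / 2`, i.e. the transition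
density after time `t` of the walk with `N(0, 1/2)` steps, for real `t > 0`. -/
noncomputable def heat (t x : ℝ) : ℝ := (√(Real.pi * t))⁻¹ * Real.exp (-(x ^ 2) / t)

theorem heat_pos {t : ℝ} (ht : 0 < t) (x : ℝ) : 0 < heat t x := by
  have := Real.pi_pos
  unfold heat
  positivity

theorem heat_nonneg (t x : ℝ) : 0 ≤ heat t x := by
  unfold heat
  positivity

theorem heat_neg (t x : ℝ) : heat t (-x) = heat t x := by simp [heat]

theorem heat_sub_comm (t x y : ℝ) : heat t (x - y) = heat t (y - x) := by
  rw [← heat_neg, neg_sub]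

@[fun_prop]
theorem continuous_heat (t : ℝ) : Continuous (heat t) := by
  unfold heat
  fun_prop

theorem gaussianPDF_eq_heat (x : ℝ) : gaussianPDF 0 (1 / 2) x = ENNReal.ofReal (heat 1 x) := by
  unfold gaussianPDF gaussianPDFReal heat
  congr 2
  · congr 2
    push_cast
    ring
  · congr 1
    push_cast
    ring

/-- Completing the square in the product of two transition densities. -/
theorem heat_mul_heat {s t : ℝ} (hs : 0 < s) (ht : 0 < t) (x y z : ℝ) :
    heat s (x - z) * heat t (z - y) = heat (s + t) (x - y) *
      ((√(Real.pi * (s * t / (s + t))))⁻¹ *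
        Real.exp (-((z - (t * x + s * y) / (s + t)) ^ 2) / (s * t / (s + t)))) := by
  have hpi := Real.pi_pos
  have hst : 0 < s + t := by positivity
  have h1 : (√(Real.pi * s))⁻¹ * (√(Real.pi * t))⁻¹
      = (√(Real.pi * (s + t)))⁻¹ * (√(Real.pi * (s * t / (s + t))))⁻¹ := by
    rw [← mul_inv, ← mul_inv, ← Real.sqrt_mul (by positivity), ← Real.sqrt_mul (by positivity)]
    congr 2
    field_simp
  have h2 : Real.exp (-((x - z) ^ 2) / s) * Real.exp (-((z - y) ^ 2) / t)
      = Real.exp (-((x - y) ^ 2) / (s + t)) *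
        Real.exp (-((z - (t * x + s * y) / (s + t)) ^ 2) / (s * t / (s + t))) := by
    rw [← Real.exp_add, ← Real.exp_add]
    congr 1
    field_simp
    ring
  unfold heat
  calc _ = ((√(Real.pi * s))⁻¹ * (√(Real.pi * t))⁻¹) *
        (Real.exp (-((x - z) ^ 2) / s) * Real.exp (-((z - y) ^ 2) / t)) := by ring
    _ = _ := by rw [h1, h2]; ring

theorem integrable_heat {t : ℝ} (ht : 0 < t) (m : ℝ) : Integrable fun z => heat t (z - m) := by
  have h := (integrable_exp_neg_mul_sq (b := t⁻¹) (by positivity)).comp_sub_right m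
  refine (h.const_mul (√(Real.pi * t))⁻¹).congr (Filter.Eventually.of_forall fun z => ?_)
  simp only [heat]
  congr 2
  field_simp

theorem integral_heat {t : ℝ} (ht : 0 < t) (m : ℝ) : ∫ z, heat t (z - m) = 1 := by
  rw [integral_sub_right_eq_self (heat t) m]
  have hpi := Real.pi_pos
  have h : ∀ z, heat t z = (√(Real.pi * t))⁻¹ * Real.exp (-t⁻¹ * z ^ 2) := by
    intro z
    simp only [heat]
    congr 2
    field_simp
  simp_rw [h]
  rw [integral_const_mul, integral_gaussian, div_inv_eq_mul]
  exact inv_mul_cancel₀ (by positivity)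

theorem integrable_heat_mul_heat {s t : ℝ} (hs : 0 < s) (ht : 0 < t) (x y : ℝ) :
    Integrable fun z => heat s (x - z) * heat t (z - y) := by
  have hp : 0 < s * t / (s + t) := by positivity
  simp_rw [heat_mul_heat hs ht x y]
  exact (integrable_heat hp _).const_mul _

/-- Chapman–Kolmogorov equation for the Gaussian transition densities. -/
theorem integral_heat_mul_heat {s t : ℝ} (hs : 0 < s) (ht : 0 < t) (x y : ℝ) :
    ∫ z, heat s (x - z) * heat t (z - y) = heat (s + t) (x - y) := by
  have hp : 0 < s * t / (s + t) := by positivity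
  simp_rw [heat_mul_heat hs ht x y]
  rw [integral_const_mul]
  have := integral_heat hp ((t * x + s * y) / (s + t))
  simp only [heat] at this
  rw [this, mul_one]

/-! ### Path weights -/

/-- The weight of the paths of the walk that go from `r` to `u` in `n + 1` steps and whose `n`
intermediate positions lie in `S 0, …, S (n - 1)`: the joint density of the positions, integrated
over the intermediate ones. It is defined by recursion on the first step. -/
noncomputable def pathWeight : ℕ → (ℕ → Set ℝ) → ℝ → ℝ → ℝ≥0∞
  | 0, _, r, u => ENNReal.ofReal (heat 1 (r - u))
  | n + 1, S, r, u =>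
    ∫⁻ t in S 0, ENNReal.ofReal (heat 1 (r - t)) * pathWeight n (fun i => S (i + 1)) t u

theorem measurable_pathWeight (n : ℕ) (S : ℕ → Set ℝ) :
    Measurable fun p : ℝ × ℝ => pathWeight n S p.1 p.2 := by
  induction n generalizing S with
  | zero =>
    simp only [pathWeight]
    fun_prop
  | succ n ih =>
    simp only [pathWeight]
    refine Measurable.lintegral_prod_right' (f := fun q : (ℝ × ℝ) × ℝ =>
      ENNReal.ofReal (heat 1 (q.1.1 - q.2)) * pathWeight n (fun i => S (i + 1)) q.2 q.1.2) ?_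
    refine Measurable.mul (by fun_prop) ?_
    exact (ih fun i => S (i + 1)).comp (by fun_prop : Measurable fun q : (ℝ × ℝ) × ℝ =>
      (q.2, q.1.2))

theorem measurable_pathWeight_left (n : ℕ) (S : ℕ → Set ℝ) (u : ℝ) :
    Measurable fun t => pathWeight n S t u :=
  (measurable_pathWeight n S).comp (by fun_prop : Measurable fun t : ℝ => (t, u))

theorem measurable_pathWeight_right (n : ℕ) (S : ℕ → Set ℝ) (r : ℝ) :
    Measurable fun t => pathWeight n S r t :=
  (measurable_pathWeight n S).comp (by fun_prop : Measurable fun t : ℝ => (r, t))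

theorem pathWeight_mono (n : ℕ) {S T : ℕ → Set ℝ} (h : ∀ i < n, S i ⊆ T i) (r u : ℝ) :
    pathWeight n S r u ≤ pathWeight n T r u := by
  induction n generalizing S T r with
  | zero => exact le_rfl
  | succ n ih =>
    simp only [pathWeight]
    refine (lintegral_mono_set (h 0 n.succ_pos)).trans (lintegral_mono fun t => ?_)
    gcongr
    exact ih (fun i hi => h _ (Nat.succ_lt_succ hi)) t

/-- Markov property: splitting the paths at their `i`-th intermediate position. -/
theorem pathWeight_split (i n : ℕ) (S : ℕ → Set ℝ) (r u : ℝ) :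
    pathWeight (i + 1 + n) S r u
      = ∫⁻ y in S i, pathWeight i S r y * pathWeight n (fun l => S (l + (i + 1))) y u := by
  induction i generalizing S r with
  | zero =>
    rw [show 0 + 1 + n = n + 1 by ring]
    simp [pathWeight]
  | succ i ih =>
    rw [show i + 1 + 1 + n = (i + 1 + n) + 1 by ring]
    simp only [pathWeight, ih]
    have h1 : ∀ t, Measurable fun y => pathWeight i (fun l => S (l + 1)) t y *
        pathWeight n (fun l => S (l + (i + 1) + 1)) y u := fun t =>
      (measurable_pathWeight_right _ _ _).mul (measurable_pathWeight_left _ _ _)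
    have h2 : ∀ y, Measurable fun t => ENNReal.ofReal (heat 1 (r - t)) *
        pathWeight i (fun l => S (l + 1)) t y := fun y =>
      Measurable.mul (by fun_prop) (measurable_pathWeight_left _ _ _)
    simp_rw [← lintegral_const_mul _ (h1 _), ← lintegral_mul_const _ (h2 _)]
    rw [lintegral_lintegral_swap]
    · simp only [mul_assoc, add_assoc]
    · refine Measurable.aemeasurable ?_
      refine Measurable.mul (by fun_prop) (Measurable.mul ?_ ?_)
      · exact measurable_pathWeight _ _
      · exact (measurable_pathWeight_left _ _ _).comp measurable_snd

theorem measurableSet_tube (n : ℕ) {S : ℕ → Set ℝ} (hS : ∀ i, MeasurableSet (S i)) :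
    MeasurableSet {x : Fin n → ℝ | ∀ i : Fin n, x i ∈ S i} := by
  rw [Set.ofPred_forall]
  exact MeasurableSet.iInter fun i => measurable_pi_apply i (hS i)

/-- The unnormalised bridge law charges a tube with the weight of the paths in that tube. -/
theorem bridgeUnnorm_tube (n : ℕ) {S : ℕ → Set ℝ} (hS : ∀ i, MeasurableSet (S i)) (r u : ℝ) :
    bridgeUnnorm n r u {x | ∀ i : Fin n, x i ∈ S i} = pathWeight n S r u := by
  have hmeas : ∀ (m : ℕ) (r : ℝ), Measurable fun x : Fin m → ℝ =>
      walkDensity (m + 1) r (Fin.snoc x u : Fin (m + 1) → ℝ) := fun m r =>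
    (measurable_walkDensity (m + 1) r).comp
      ((measurable_snoc_fst m).comp (measurable_id.prodMk measurable_const))
  induction n generalizing S r with
  | zero =>
    have h0 : {x : Fin 0 → ℝ | ∀ i : Fin 0, x i ∈ S i} = Set.univ := by
      ext x; simp
    rw [h0, bridgeUnnorm, withDensity_apply _ MeasurableSet.univ, Measure.restrict_univ, volume_pi,
      Measure.pi_of_empty _ 0, lintegral_dirac' _ (hmeas 0 r), walkDensity_snoc, gaussianPDF_eq_heat]
    simp [walkDensity, pathWeight, heat_sub_comm 1 u r]
  | succ n ih =>
    have hT := measurableSet_tube (n + 1) hS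
    rw [bridgeUnnorm, withDensity_apply _ hT, ← lintegral_indicator hT, volume_pi,
      lintegral_pi_cons n _ _ ((hmeas (n + 1) r).indicator hT), pathWeight,
      ← lintegral_indicator (hS 0)]
    refine lintegral_congr fun t => ?_
    have hT' := measurableSet_tube n fun i => hS (i + 1)
    by_cases ht : t ∈ S 0
    · rw [Set.indicator_of_mem ht, ← ih (fun i => hS (i + 1)) t, bridgeUnnorm,
        withDensity_apply _ hT', ← lintegral_indicator hT', ← volume_pi,
        ← lintegral_const_mul _ ((hmeas n t).indicator hT')]
      refine lintegral_congr fun y => ?_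
      have hd : walkDensity (n + 1 + 1) r
          (Fin.snoc (Fin.cons t y : Fin (n + 1) → ℝ) u : Fin (n + 1 + 1) → ℝ)
          = ENNReal.ofReal (heat 1 (r - t)) *
            walkDensity (n + 1) t (Fin.snoc y u : Fin (n + 1) → ℝ) := by
        rw [← Fin.cons_snoc_eq_snoc_cons, walkDensity_cons, gaussianPDF_eq_heat,
          heat_sub_comm 1 t r]
      by_cases hy : ∀ i : Fin n, y i ∈ S (i + 1)
      · rw [Set.indicator_of_mem, Set.indicator_of_mem (by simpa using hy), hd]
        simpa [Fin.forall_fin_succ, ht] using hy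
      · rw [Set.indicator_of_notMem, Set.indicator_of_notMem (by simpa using hy), mul_zero]
        simpa [Fin.forall_fin_succ, ht] using hy
    · rw [Set.indicator_of_notMem ht]
      refine (lintegral_congr fun y => ?_).trans lintegral_zero
      refine Set.indicator_of_notMem ?_ _
      simp [Fin.forall_fin_succ, ht]

theorem pathWeight_univ (n : ℕ) (r u : ℝ) :
    pathWeight n (fun _ => Set.univ) r u = ENNReal.ofReal (heat (n + 1) (r - u)) := by
  induction n generalizing r with
  | zero => simp [pathWeight]
  | succ n ih =>
    have hn : (0 : ℝ) < n + 1 := by positivity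
    simp only [pathWeight, ih, ← ENNReal.ofReal_mul (heat_nonneg _ _)]
    rw [Measure.restrict_univ, ← ofReal_integral_eq_lintegral_ofReal
      (integrable_heat_mul_heat one_pos hn r u)
      (Filter.Eventually.of_forall fun t => mul_nonneg (heat_nonneg _ _) (heat_nonneg _ _)),
      integral_heat_mul_heat one_pos hn, Nat.cast_succ, add_comm 1]

theorem pathWeight_le_heat (n : ℕ) (S : ℕ → Set ℝ) (r u : ℝ) :
    pathWeight n S r u ≤ ENNReal.ofReal (heat (n + 1) (r - u)) :=
  (pathWeight_mono n (fun _ _ => Set.subset_univ _) r u).trans_eq (pathWeight_univ n r u)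

theorem bridgeLaw_tube (n : ℕ) {S : ℕ → Set ℝ} (hS : ∀ i, MeasurableSet (S i)) (r u : ℝ) :
    (bridgeLaw n r u).real {x | ∀ i : Fin n, x i ∈ S i}
      = (pathWeight n S r u).toReal / heat (n + 1) (r - u) := by
  have h : bridgeUnnorm n r u Set.univ = ENNReal.ofReal (heat (n + 1) (r - u)) := by
    rw [← pathWeight_univ, ← bridgeUnnorm_tube n (fun _ => MeasurableSet.univ)]
    simp
  rw [Measure.real, bridgeLaw, Measure.smul_apply, h, bridgeUnnorm_tube n hS, smul_eq_mul,
    ENNReal.toReal_mul, ENNReal.toReal_inv, ENNReal.toReal_ofReal (heat_nonneg _ _)]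
  ring

/-! ### Walks above a constant level -/

/-- The transition density from `x` to `u` of Brownian motion (of variance `1 / 2` per unit of
time) killed at the level `c`: by the reflection principle the image `2 * c - u` of the endpoint
is subtracted. -/
noncomputable def killedHeat (c u t x : ℝ) : ℝ := heat t (x - u) - heat t (x - (2 * c - u))

theorem killedHeat_eq {t : ℝ} (ht : 0 < t) (c u x : ℝ) :
    killedHeat c u t x = heat t (x - u) * (1 - Real.exp (-(4 * (x - c) * (u - c) / t))) := by
  unfold killedHeat heat
  rw [mul_sub, mul_one, mul_assoc _ (Real.exp _), ← Real.exp_add]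
  congr 3
  field_simp
  ring

theorem killedHeat_nonneg {t c u x : ℝ} (ht : 0 < t) (hx : c ≤ x) (hu : c ≤ u) :
    0 ≤ killedHeat c u t x := by
  rw [killedHeat_eq ht]
  refine mul_nonneg (heat_nonneg _ _) (sub_nonneg.2 (Real.exp_le_one_iff.2 ?_))
  have : 0 ≤ (x - c) * (u - c) := mul_nonneg (by linarith) (by linarith)
  rw [neg_nonpos]
  positivity

theorem killedHeat_reflect (c u t w : ℝ) :
    killedHeat c u t (c - w) = -killedHeat c u t (c + w) := by
  unfold killedHeat
  rw [← heat_neg t (c - w - u), ← heat_neg t (c - w - (2 * c - u))]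
  ring_nf

theorem integrable_killedHeat {t : ℝ} (ht : 0 < t) (c u x : ℝ) :
    Integrable fun z => heat 1 (x - z) * killedHeat c u t z := by
  simp only [killedHeat, mul_sub]
  exact (integrable_heat_mul_heat one_pos ht _ _).sub (integrable_heat_mul_heat one_pos ht _ _)

theorem integral_killedHeat {t : ℝ} (ht : 0 < t) (c u x : ℝ) :
    ∫ z, heat 1 (x - z) * killedHeat c u t z = killedHeat c u (1 + t) x := by
  simp only [killedHeat, mul_sub]
  rw [integral_sub (integrable_heat_mul_heat one_pos ht _ _)
    (integrable_heat_mul_heat one_pos ht _ _), integral_heat_mul_heat one_pos ht,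
    integral_heat_mul_heat one_pos ht]

/-- One step of the walk restricted to `[b, ∞)`, applied to the killed density: the unrestricted
step only advances the time, so the sign of the integral below `b` decides whether the killed
density is a subsolution or a supersolution. -/
theorem lintegral_Ici_killedHeat {t c b u x : ℝ} (ht : 0 < t) (hb : c ≤ b) (hu : c ≤ u) :
    ∫⁻ z in Set.Ici b, ENNReal.ofReal (heat 1 (x - z)) * ENNReal.ofReal (killedHeat c u t z)
      = ENNReal.ofReal (killedHeat c u (1 + t) x
          - ∫ z in Set.Iio b, heat 1 (x - z) * killedHeat c u t z) := by
  have hi := integrable_killedHeat ht c u x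
  have h := integral_add_compl (measurableSet_Iio (a := b)) hi
  rw [integral_killedHeat ht, Set.compl_Iio] at h
  rw [← h, add_sub_cancel_left, ofReal_integral_eq_lintegral_ofReal hi.integrableOn]
  · exact lintegral_congr fun z => (ENNReal.ofReal_mul (heat_nonneg _ _)).symm
  · refine (ae_restrict_mem measurableSet_Ici).mono fun z hz => ?_
    exact mul_nonneg (heat_nonneg _ _) (killedHeat_nonneg ht (hb.trans hz) hu)

/-- Observing Brownian motion only at integer times can only make survival more likely. -/
theorem killedHeat_le_pathWeight (n : ℕ) {b r u : ℝ} (hr : b ≤ r) (hu : b ≤ u) :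
    ENNReal.ofReal (killedHeat b u (n + 1) r) ≤ pathWeight n (fun _ => Set.Ici b) r u := by
  induction n generalizing r with
  | zero =>
    simp only [pathWeight, Nat.cast_zero, zero_add]
    exact ENNReal.ofReal_le_ofReal (sub_le_self _ (heat_nonneg _ _))
  | succ n ih =>
    have hn : (0 : ℝ) < n + 1 := by positivity
    simp only [pathWeight]
    calc ENNReal.ofReal (killedHeat b u ((n + 1 : ℕ) + 1) r)
        ≤ ENNReal.ofReal (killedHeat b u (1 + (n + 1)) r
          - ∫ z in Set.Iio b, heat 1 (r - z) * killedHeat b u (n + 1) z) := by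
          refine ENNReal.ofReal_le_ofReal ?_
          have hneg : ∫ z in Set.Iio b, heat 1 (r - z) * killedHeat b u (n + 1) z ≤ 0 := by
            refine setIntegral_nonpos measurableSet_Iio fun z hz => ?_
            refine mul_nonpos_of_nonneg_of_nonpos (heat_nonneg _ _) ?_
            have h1 := killedHeat_reflect b u (n + 1) (b - z)
            have h2 : 0 ≤ killedHeat b u (n + 1) (b + (b - z)) :=
              killedHeat_nonneg hn (by linarith [Set.mem_Iio.1 hz]) hu
            rw [sub_sub_cancel] at h1
            linarith
          have he : ((n + 1 : ℕ) : ℝ) + 1 = 1 + (n + 1) := by push_cast; ring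
          rw [he]
          linarith
      _ = ∫⁻ z in Set.Ici b, ENNReal.ofReal (heat 1 (r - z)) *
            ENNReal.ofReal (killedHeat b u (n + 1) z) :=
          (lintegral_Ici_killedHeat hn le_rfl hu).symm
      _ ≤ _ := by
          refine setLIntegral_mono' measurableSet_Ici fun z hz => ?_
          gcongr
          exact ih hz

theorem sinh_mul_le {α w : ℝ} (hα : 0 ≤ α) (hα2 : α ≤ 2) (hw : 0 ≤ w) :
    Real.sinh (α * w) ≤ Real.sinh α * Real.exp (3 * w) := by
  have h1 : Real.sinh (α * w) ≤ α * w * Real.exp (α * w) := by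
    have h0 : 0 ≤ α * w := by positivity
    have e : Real.exp (-(α * w)) * Real.exp (α * w) = 1 := by rw [← Real.exp_add]; simp
    have h2 : 1 - 2 * (α * w) ≤ Real.exp (-(α * w)) * Real.exp (-(α * w)) := by
      rw [← Real.exp_add]
      linarith [Real.add_one_le_exp (-(α * w) + -(α * w))]
    have h3 := mul_le_mul_of_nonneg_right h2 (Real.exp_pos (α * w)).le
    rw [mul_assoc, e] at h3
    rw [Real.sinh_eq]
    linarith
  have h4 : α ≤ Real.sinh α := Real.self_le_sinh_iff.2 hα
  have h5 : w ≤ Real.exp w := by linarith [Real.add_one_le_exp w]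
  have h6 : Real.exp (α * w) ≤ Real.exp (2 * w) := Real.exp_le_exp.2 (by gcongr)
  calc _ ≤ α * w * Real.exp (α * w) := h1
    _ ≤ Real.sinh α * Real.exp w * Real.exp (2 * w) := by gcongr
    _ = _ := by rw [mul_assoc, ← Real.exp_add]; ring_nf

theorem killedHeat_eq_sinh {t : ℝ} (ht : 0 < t) (c u w : ℝ) :
    killedHeat c u t (c + w) = 2 * (√(Real.pi * t))⁻¹ * Real.exp (-(u - c) ^ 2 / t) *
      (Real.exp (-w ^ 2 / t) * Real.sinh (2 * (u - c) / t * w)) := by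
  have e1 : Real.exp (-(c + w - u) ^ 2 / t) = Real.exp (-(u - c) ^ 2 / t) *
      (Real.exp (-w ^ 2 / t) * Real.exp (2 * (u - c) / t * w)) := by
    rw [← Real.exp_add, ← Real.exp_add]
    congr 1
    field_simp
    ring
  have e2 : Real.exp (-(c + w - (2 * c - u)) ^ 2 / t) = Real.exp (-(u - c) ^ 2 / t) *
      (Real.exp (-w ^ 2 / t) * Real.exp (-(2 * (u - c) / t * w))) := by
    rw [← Real.exp_add, ← Real.exp_add]
    congr 1
    field_simp
    ring
  unfold killedHeat heat
  rw [e1, e2, Real.sinh_eq]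
  ring

/-- Here `w` is the distance to the reflection level and `v` that of the endpoint of the step: the
negative part of the killed density decays in `w`, after the factor common to all `w` is removed. -/
theorem negative_tail_le {α t v w : ℝ} (ht : 0 < t) (hα : 0 ≤ α) (hα2 : α ≤ 2) (hv : 2 ≤ v)
    (hw : 0 ≤ w) :
    Real.exp (-w ^ 2 / t) * Real.exp (-w ^ 2) * Real.sinh (α * w) * Real.exp (-(2 * v * w))
      ≤ Real.sinh α * Real.exp (-w) := by
  have hsα : 0 ≤ Real.sinh α := Real.sinh_nonneg_iff.2 hα
  have hsw : 0 ≤ Real.sinh (α * w) := Real.sinh_nonneg_iff.2 (by positivity)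
  have h1 : Real.exp (-w ^ 2 / t) ≤ 1 := by
    refine Real.exp_le_one_iff.2 ?_
    rw [neg_div, neg_nonpos]
    positivity
  have h2 : Real.exp (-w ^ 2) ≤ 1 := by
    refine Real.exp_le_one_iff.2 ?_
    rw [neg_nonpos]
    positivity
  calc _ ≤ 1 * 1 * (Real.sinh α * Real.exp (3 * w)) * Real.exp (-(2 * v * w)) := by
        gcongr
        exact sinh_mul_le hα hα2 hw
    _ = Real.sinh α * Real.exp (3 * w - 2 * v * w) := by
        rw [sub_eq_add_neg, Real.exp_add]
        ring
    _ ≤ _ := by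
        gcongr
        have := mul_le_mul_of_nonneg_right hv hw
        linarith

/-- Counterpart of `negative_tail_le`: at distance between `1` and `2` from the reflection level, the
contributions of the points `w` above and `-w` below it add up to at least `sinh α`. -/
theorem le_positive_bulk {α t v w : ℝ} (ht : 1 ≤ t) (hα : 0 ≤ α) (hv : 5 ≤ v) (hw1 : 1 ≤ w)
    (hw2 : w ≤ 2) :
    Real.sinh α ≤ Real.exp (-w ^ 2 / t) * Real.exp (-w ^ 2) * Real.sinh (α * w) *
      (Real.exp (2 * v * w) - Real.exp (-(2 * v * w))) := by
  have hsα : 0 ≤ Real.sinh α := Real.sinh_nonneg_iff.2 hα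
  have hvw : 5 * 1 ≤ v * w := mul_le_mul hv hw1 zero_le_one (by linarith)
  have hww : w ^ 2 ≤ 2 ^ 2 := pow_le_pow_left₀ (by linarith) hw2 2
  have h1 : Real.exp (-4) ≤ Real.exp (-w ^ 2 / t) := by
    refine Real.exp_le_exp.2 ?_
    rw [le_div_iff₀ (by linarith)]
    linarith
  have h2 : Real.exp (-4) ≤ Real.exp (-w ^ 2) := Real.exp_le_exp.2 (by linarith)
  have h3 : Real.sinh α ≤ Real.sinh (α * w) := Real.sinh_le_sinh.2 (le_mul_of_one_le_right hα hw1)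
  have h4 : Real.exp 9 ≤ Real.exp (2 * v * w) - Real.exp (-(2 * v * w)) := by
    have h5 : Real.exp 10 ≤ Real.exp (2 * v * w) := Real.exp_le_exp.2 (by linarith)
    have h6 : Real.exp (-(2 * v * w)) ≤ 1 := Real.exp_le_one_iff.2 (by linarith)
    have h7 : Real.exp 10 = Real.exp 9 * Real.exp 1 := by rw [← Real.exp_add]; norm_num
    have h8 : 2 ≤ Real.exp 1 := by linarith [Real.add_one_le_exp 1]
    have h9 : 1 ≤ Real.exp 9 := by linarith [Real.add_one_le_exp 9]
    have h10 := mul_le_mul_of_nonneg_left h8 (Real.exp_pos 9).le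
    linarith
  calc Real.sinh α ≤ Real.sinh α * Real.exp 1 :=
        le_mul_of_one_le_right hsα (Real.one_le_exp (by norm_num))
    _ = Real.exp (-4) * Real.exp (-4) * Real.sinh α * Real.exp 9 := by
        rw [show (1 : ℝ) = -4 + -4 + 9 by norm_num, Real.exp_add, Real.exp_add]
        ring
    _ ≤ _ := by gcongr

/-- For a level `c + s` well above the reflection level `c`, one step of the walk from above
`c + s` sees more of the positive part of the killed transition density on `[c, c + s]` than of
its negative part below `c`. The positive mass is taken from `[c + 1, c + 2]`, the tail of the
negative mass below `c - s` being exponentially small in comparison. -/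
theorem integral_Iio_killedHeat_nonneg {t c u s x : ℝ} (hs : 5 ≤ s) (ht : 1 ≤ t) (hu : c ≤ u)
    (hut : u - c ≤ t) (hx : c + s ≤ x) :
    0 ≤ ∫ z in Set.Iio (c + s), heat 1 (x - z) * killedHeat c u t z := by
  have ht0 : 0 < t := by linarith
  set g : ℝ → ℝ := fun w => heat 1 (x - (c + w)) * killedHeat c u t (c + w) with hg
  have hgi : Integrable g := (integrable_killedHeat ht0 c u x).comp_add_left c
  have hgi' : Integrable fun w => g (-w) := hgi.comp_neg
  -- unfold the integral about the level `c`
  have hfold : ∫ z in Set.Iio (c + s), heat 1 (x - z) * killedHeat c u t z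
      = ∫ w in Set.Ioi 0, ((Set.Iio s).indicator g w + g (-w)) := by
    have h1 : ∫ z in Set.Iio (c + s), heat 1 (x - z) * killedHeat c u t z
        = ∫ w, (Set.Iio s).indicator g w := by
      rw [← integral_indicator measurableSet_Iio, ← integral_add_left_eq_self _ c]
      refine integral_congr_ae (Filter.Eventually.of_forall fun w => ?_)
      by_cases hw : w < s <;> simp [Set.indicator, hw, hg]
    have hi : Integrable ((Set.Iio s).indicator g) := hgi.indicator measurableSet_Iio
    have h2 := integral_add_compl (measurableSet_Ioi (a := (0 : ℝ))) hi
    rw [h1, ← h2, integral_add hi.integrableOn hgi'.integrableOn, Set.compl_Ioi]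
    congr 1
    rw [integral_comp_neg_Ioi (0 : ℝ) g, neg_zero]
    refine setIntegral_congr_fun measurableSet_Iic fun w hw => ?_
    refine Set.indicator_of_mem ?_ g
    simp only [Set.mem_Iic, Set.mem_Iio] at hw ⊢
    linarith
  set v := x - c with hv
  have hvs : s ≤ v := by linarith
  set α := 2 * (u - c) / t with hα
  have hα0 : 0 ≤ α := by
    have : 0 ≤ u - c := by linarith
    positivity
  have hα2 : α ≤ 2 := by
    rw [hα, div_le_iff₀ ht0]
    linarith
  have hsα : 0 ≤ Real.sinh α := Real.sinh_nonneg_iff.2 hα0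
  set D := 2 * (√(Real.pi * t))⁻¹ * Real.exp (-(u - c) ^ 2 / t) * (√(Real.pi * 1))⁻¹ *
    Real.exp (-v ^ 2) with hD
  have hD0 : 0 ≤ D := by positivity
  have hgw : ∀ w, g w = D * (Real.exp (-w ^ 2 / t) * Real.exp (-w ^ 2) *
      Real.sinh (α * w) * Real.exp (2 * v * w)) := by
    intro w
    have e : Real.exp (-(x - (c + w)) ^ 2 / 1)
        = Real.exp (-v ^ 2) * Real.exp (-w ^ 2) * Real.exp (2 * v * w) := by
      rw [← Real.exp_add, ← Real.exp_add, hv]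
      congr 1
      ring
    simp only [hg]
    rw [killedHeat_eq_sinh ht0, hD, heat, e]
    ring
  have hgn : ∀ w, g (-w) = -(D * (Real.exp (-w ^ 2 / t) * Real.exp (-w ^ 2) *
      Real.sinh (α * w) * Real.exp (-(2 * v * w)))) := by
    intro w
    rw [hgw, mul_neg, Real.sinh_neg, neg_sq, mul_neg]
    ring_nf
  set M := D * Real.sinh α with hM
  have hM0 : 0 ≤ M := by positivity
  have hbound : ∀ w ∈ Set.Ioi (0 : ℝ), (Set.Icc (1 : ℝ) 2).indicator (fun _ => M) w
      - M * Real.exp (-w) ≤ (Set.Iio s).indicator g w + g (-w) := by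
    intro w hw
    have hw0 : 0 < w := hw
    by_cases hws : s ≤ w
    · have h12 : w ∉ Set.Icc (1 : ℝ) 2 := fun h => by linarith [h.2]
      have hIio : w ∉ Set.Iio s := hws.not_gt
      rw [Set.indicator_of_notMem h12, Set.indicator_of_notMem hIio, hgn, zero_sub, zero_add, hM,
        mul_assoc]
      exact neg_le_neg (mul_le_mul_of_nonneg_left
        (negative_tail_le ht0 hα0 hα2 (by linarith) hw0.le) hD0)
    · have hws' : w < s := not_le.1 hws
      have hsum : g w + g (-w) = D * (Real.exp (-w ^ 2 / t) * Real.exp (-w ^ 2) *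
          Real.sinh (α * w) * (Real.exp (2 * v * w) - Real.exp (-(2 * v * w)))) := by
        rw [hgw, hgn]
        ring
      have hMe : 0 ≤ M * Real.exp (-w) := by positivity
      rw [Set.indicator_of_mem (Set.mem_Iio.2 hws'), hsum]
      refine (sub_le_self _ hMe).trans ?_
      by_cases hw12 : w ∈ Set.Icc (1 : ℝ) 2
      · rw [Set.indicator_of_mem hw12, hM]
        exact mul_le_mul_of_nonneg_left
          (le_positive_bulk ht hα0 (by linarith) hw12.1 hw12.2) hD0
      · rw [Set.indicator_of_notMem hw12]
        have hE : 0 ≤ Real.exp (2 * v * w) - Real.exp (-(2 * v * w)) := by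
          rw [sub_nonneg]
          refine Real.exp_le_exp.2 ?_
          have : 0 ≤ v * w := mul_nonneg (by linarith) hw0.le
          linarith
        have hsw : 0 ≤ Real.sinh (α * w) := Real.sinh_nonneg_iff.2 (by positivity)
        positivity
  have hexp : IntegrableOn (fun w : ℝ => Real.exp (-w)) (Set.Ioi 0) := integrableOn_exp_neg_Ioi 0
  have hint1 : IntegrableOn ((Set.Icc (1 : ℝ) 2).indicator fun _ => M) (Set.Ioi 0) :=
    ((integrable_indicator_iff measurableSet_Icc).2 (by simp)).integrableOn
  rw [hfold]
  calc (0 : ℝ) ≤ ∫ w in Set.Ioi (0 : ℝ), ((Set.Icc (1 : ℝ) 2).indicator (fun _ => M) w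
        - M * Real.exp (-w)) := by
        rw [integral_sub hint1 (hexp.const_mul M), integral_const_mul, integral_exp_neg_Ioi,
          setIntegral_indicator measurableSet_Icc]
        have : Set.Ioi (0 : ℝ) ∩ Set.Icc 1 2 = Set.Icc 1 2 :=
          Set.inter_eq_right.2 fun w hw => lt_of_lt_of_le one_pos hw.1
        rw [this, setIntegral_const]
        norm_num
    _ ≤ _ := by
        refine setIntegral_mono_on (hint1.sub (hexp.const_mul M)) ?_ measurableSet_Ioi
          hbound
        exact ((hgi.indicator measurableSet_Iio).add hgi').integrableOn

/-- Crossing the level `b` by overshooting it by more than `s` is so unlikely that the walk above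
`b` is dominated, up to a factor close to `1`, by Brownian motion above `b - s`. For
`n + 1 ≤ 2 * (u - b + s)` the factor covers the difference between the killed and the free
transition density; after that `killedHeat` is a supersolution. -/
theorem pathWeight_le_killedHeat (n : ℕ) {b r u s : ℝ} (hs : 5 ≤ s) (hr : b ≤ r) (hu : b ≤ u) :
    pathWeight n (fun _ => Set.Ici b) r u
      ≤ ENNReal.ofReal ((1 - Real.exp (-(2 * s)))⁻¹ * killedHeat (b - s) u (n + 1) r) := by
  have hA : 0 < 1 - Real.exp (-(2 * s)) := by
    rw [sub_pos, Real.exp_lt_one_iff]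
    linarith
  have hsmall : ∀ (n : ℕ) (r : ℝ), b ≤ r → (n + 1 : ℝ) ≤ 2 * (u - (b - s)) →
      pathWeight n (fun _ => Set.Ici b) r u
        ≤ ENNReal.ofReal ((1 - Real.exp (-(2 * s)))⁻¹ * killedHeat (b - s) u (n + 1) r) := by
    intro n r hr hn
    refine (pathWeight_le_heat n _ r u).trans (ENNReal.ofReal_le_ofReal ?_)
    have hn0 : (0 : ℝ) < n + 1 := by positivity
    rw [killedHeat_eq hn0, le_inv_mul_iff₀ hA, mul_comm]
    refine mul_le_mul_of_nonneg_left ?_ (heat_nonneg _ _)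
    refine sub_le_sub_left (Real.exp_le_exp.2 (neg_le_neg ?_)) 1
    rw [le_div_iff₀ hn0]
    have h1 := mul_le_mul_of_nonneg_left hn (show 0 ≤ 2 * s by linarith)
    have h2 : s * (u - (b - s)) ≤ (r - (b - s)) * (u - (b - s)) :=
      mul_le_mul_of_nonneg_right (by linarith) (by linarith)
    linarith
  induction n generalizing r with
  | zero => exact hsmall 0 r hr (by push_cast; linarith)
  | succ n ih =>
    by_cases hn : ((n + 1 : ℕ) + 1 : ℝ) ≤ 2 * (u - (b - s))
    · exact hsmall (n + 1) r hr hn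
    push_cast at hn
    have hn1 : (1 : ℝ) ≤ n + 1 := by
      have : (0 : ℝ) ≤ n := n.cast_nonneg
      linarith
    have hn0 : (0 : ℝ) < n + 1 := by linarith
    simp only [pathWeight]
    calc _ ≤ ∫⁻ z in Set.Ici b, ENNReal.ofReal ((1 - Real.exp (-(2 * s)))⁻¹) *
          (ENNReal.ofReal (heat 1 (r - z)) *
            ENNReal.ofReal (killedHeat (b - s) u (n + 1) z)) := by
          refine setLIntegral_mono' measurableSet_Ici fun z hz => ?_
          rw [mul_left_comm, ← ENNReal.ofReal_mul (inv_nonneg.2 hA.le)]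
          gcongr
          exact ih hz
      _ = ENNReal.ofReal ((1 - Real.exp (-(2 * s)))⁻¹) *
          ENNReal.ofReal (killedHeat (b - s) u (1 + (n + 1)) r
            - ∫ z in Set.Iio b, heat 1 (r - z) * killedHeat (b - s) u (n + 1) z) := by
          rw [lintegral_const_mul' _ _ ENNReal.ofReal_ne_top,
            lintegral_Ici_killedHeat hn0 (by linarith) (by linarith)]
      _ ≤ _ := by
          rw [ENNReal.ofReal_mul (inv_nonneg.2 hA.le)]
          gcongr
          have h := integral_Iio_killedHeat_nonneg (c := b - s) (u := u) (x := r) hs hn1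
            (by linarith) (by linarith) (by linarith)
          rw [sub_add_cancel] at h
          have he : ((n + 1 : ℕ) : ℝ) + 1 = 1 + (n + 1) := by push_cast; ring
          rw [he]
          linarith

/-- Upper bound of the right order for the walk above a constant level, uniform in the
endpoints. -/
theorem pathWeight_le_mul (n : ℕ) {b r u : ℝ} (hr : b ≤ r) (hu : b ≤ u) :
    pathWeight n (fun _ => Set.Ici b) r u
      ≤ ENNReal.ofReal (5 * ((r - b + 5) * (u - b + 5) / (n + 1)) * heat (n + 1) (r - u)) := by
  refine (pathWeight_le_killedHeat n le_rfl hr hu).trans (ENNReal.ofReal_le_ofReal ?_)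
  have hn : (0 : ℝ) < n + 1 := by positivity
  have hA : (1 - Real.exp (-(2 * 5)))⁻¹ ≤ (5 / 4 : ℝ) := by
    have h1 : (11 : ℝ) ≤ Real.exp (2 * 5) := by linarith [Real.add_one_le_exp (2 * 5 : ℝ)]
    have h2 : Real.exp (-(2 * 5)) ≤ (11 : ℝ)⁻¹ := by
      rw [Real.exp_neg]
      exact inv_anti₀ (by norm_num) h1
    norm_num at h2 ⊢
    rw [inv_le_comm₀ (by linarith) (by norm_num)]
    linarith
  have hB : 1 - Real.exp (-(4 * (r - (b - 5)) * (u - (b - 5)) / (n + 1)))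
      ≤ 4 * (r - (b - 5)) * (u - (b - 5)) / (n + 1) := by
    linarith [Real.one_sub_le_exp_neg (4 * (r - (b - 5)) * (u - (b - 5)) / (n + 1))]
  have h0 : 0 ≤ killedHeat (b - 5) u (n + 1) r :=
    killedHeat_nonneg hn (by linarith) (by linarith)
  refine (mul_le_mul_of_nonneg_right hA h0).trans ?_
  rw [killedHeat_eq hn]
  refine (mul_le_mul_of_nonneg_left (mul_le_mul_of_nonneg_left hB (heat_nonneg _ _))
    (by norm_num)).trans_eq ?_
  ring

theorem le_bridgeLaw_Ici (n : ℕ) {b r u : ℝ} (hr : b ≤ r) (hu : b ≤ u) :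
    1 - Real.exp (-(4 * (r - b) * (u - b) / (n + 1)))
      ≤ (bridgeLaw n r u).real {x | ∀ i : Fin n, x i ∈ Set.Ici b} := by
  have hn : (0 : ℝ) < n + 1 := by positivity
  have hfin : pathWeight n (fun _ => Set.Ici b) r u ≠ ∞ :=
    ((pathWeight_le_heat n _ r u).trans_lt ENNReal.ofReal_lt_top).ne
  have h := killedHeat_le_pathWeight n hr hu
  rw [ENNReal.ofReal_le_iff_le_toReal hfin, killedHeat_eq hn] at h
  rw [bridgeLaw_tube n (S := fun _ => Set.Ici b) (fun _ => measurableSet_Ici),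
    le_div_iff₀ (heat_pos hn _), mul_comm]
  exact h

theorem bridgeLaw_Ici_le (n : ℕ) {b r u s : ℝ} (hs : 5 ≤ s) (hr : b ≤ r) (hu : b ≤ u) :
    (bridgeLaw n r u).real {x | ∀ i : Fin n, x i ∈ Set.Ici b}
      ≤ (1 - Real.exp (-(2 * s)))⁻¹ *
        (1 - Real.exp (-(4 * (r - (b - s)) * (u - (b - s)) / (n + 1)))) := by
  have hn : (0 : ℝ) < n + 1 := by positivity
  have hA : 0 ≤ (1 - Real.exp (-(2 * s)))⁻¹ := by
    refine inv_nonneg.2 (sub_nonneg.2 (Real.exp_le_one_iff.2 ?_))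
    linarith
  have h := ENNReal.toReal_le_of_le_ofReal
    (mul_nonneg hA (killedHeat_nonneg hn (by linarith) (by linarith)))
    (pathWeight_le_killedHeat n hs hr hu)
  rw [killedHeat_eq hn] at h
  rw [bridgeLaw_tube n (S := fun _ => Set.Ici b) (fun _ => measurableSet_Ici),
    div_le_iff₀ (heat_pos hn _)]
  linarith

/-! ### Visits near the barrier -/

/-- The bridge from `r` to `u` that stays above `b` and visits the window `[y₁, y₂]` at its
`j`-th intermediate time: both halves of the path are estimated by `pathWeight_le_mul`. Here `p`
is twice the variance of the unconstrained bridge at that time, and `Λ` bounds the Gaussian factor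
of its density. -/
theorem bridgeLaw_window_le (j l : ℕ) {b r u y₁ y₂ p Λ : ℝ} (hr : b ≤ r) (hu : b ≤ u)
    (hby : b ≤ y₁) (hy : y₁ ≤ y₂)
    (hp : p = ((j : ℝ) + 1) * ((l : ℝ) + 1) / ((j : ℝ) + 1 + ((l : ℝ) + 1)))
    (hΛ : ∀ y, y ≤ y₂ → Real.exp (-(y - (((l : ℝ) + 1) * r + ((j : ℝ) + 1) * u) /
      ((j : ℝ) + 1 + ((l : ℝ) + 1))) ^ 2 / p) ≤ Λ) :
    (bridgeLaw (j + 1 + l) r u).real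
        {x | ∀ i : Fin (j + 1 + l), x i ∈ if i.val = j then Set.Icc y₁ y₂ else Set.Ici b}
      ≤ 25 * ((r - b + 5) * (u - b + 5) * (y₂ - b + 5) ^ 2) * (y₂ - y₁) *
        (p⁻¹ * (√p)⁻¹) * Λ / ((j : ℝ) + 1 + ((l : ℝ) + 1)) := by
  set s : ℝ := (j : ℝ) + 1 with hs_def
  set t : ℝ := (l : ℝ) + 1 with ht_def
  have hs : 0 < s := by positivity
  have ht : 0 < t := by positivity
  have hp0 : 0 < p := by rw [hp]; positivity
  have hΛ0 : 0 ≤ Λ := (Real.exp_pos _).le.trans (hΛ y₂ le_rfl)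
  set S : ℕ → Set ℝ := fun i => if i = j then Set.Icc y₁ y₂ else Set.Ici b with hS
  have hSm : ∀ i, MeasurableSet (S i) := fun i => by
    simp only [hS]
    split_ifs
    · exact measurableSet_Icc
    · exact measurableSet_Ici
  have hk : (((j + 1 + l : ℕ) : ℝ) + 1) = s + t := by
    rw [hs_def, ht_def]
    push_cast
    ring
  have hH := heat_pos (add_pos hs ht) (r - u)
  set B : ℝ := 25 * ((r - b + 5) * (u - b + 5) * (y₂ - b + 5) ^ 2) * (p⁻¹ * (√p)⁻¹) * Λ / (s + t)
    with hB
  have hr5 : 0 ≤ r - b + 5 := by linarith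
  have hu5 : 0 ≤ u - b + 5 := by linarith
  have hy5 : 0 ≤ y₂ - b + 5 := by linarith
  have hB0 : 0 ≤ B := by positivity
  have hsub : S j = Set.Icc y₁ y₂ := if_pos rfl
  have hpt : ∀ y ∈ Set.Icc y₁ y₂, pathWeight j S r y *
      pathWeight l (fun i => S (i + (j + 1))) y u
      ≤ ENNReal.ofReal (B * heat (s + t) (r - u)) := by
    intro y hyI
    have hyb : b ≤ y := hby.trans hyI.1
    have h1 : pathWeight j S r y ≤ _ :=
      (pathWeight_mono j (T := fun _ => Set.Ici b) (fun i hi => by simp [hS, hi.ne]) r y).trans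
        (pathWeight_le_mul j hr hyb)
    have h2 : pathWeight l (fun i => S (i + (j + 1))) y u ≤ _ :=
      (pathWeight_mono l (T := fun _ => Set.Ici b)
        (fun i _ => by simp [hS, show i + (j + 1) ≠ j by omega]) y u).trans
        (pathWeight_le_mul l hyb hu)
    refine (mul_le_mul' h1 h2).trans ?_
    have hyb5 : 0 ≤ y - b + 5 := by linarith
    rw [← ENNReal.ofReal_mul (mul_nonneg (by positivity) (heat_nonneg _ _))]
    refine ENNReal.ofReal_le_ofReal ?_
    have hpi : (√(Real.pi * p))⁻¹ ≤ (√p)⁻¹ := by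
      refine inv_anti₀ (by positivity) (Real.sqrt_le_sqrt ?_)
      exact le_mul_of_one_le_left hp0.le (by linarith [Real.pi_gt_three])
    have hst : (s * t)⁻¹ = p⁻¹ / (s + t) := by
      rw [hp]
      field_simp
    have hyy : y - b + 5 ≤ y₂ - b + 5 := by linarith [hyI.2]
    calc _ = 25 * ((r - b + 5) * (u - b + 5) * (y - b + 5) ^ 2) * (s * t)⁻¹ *
          (heat s (r - y) * heat t (y - u)) := by
          rw [← hs_def, ← ht_def]
          field_simp
          ring
      _ = 25 * ((r - b + 5) * (u - b + 5) * (y - b + 5) ^ 2) * (p⁻¹ / (s + t)) *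
          (heat (s + t) (r - u) * ((√(Real.pi * p))⁻¹ *
            Real.exp (-(y - (t * r + s * u) / (s + t)) ^ 2 / p))) := by
          rw [hst, heat_mul_heat hs ht, ← hp]
      _ ≤ 25 * ((r - b + 5) * (u - b + 5) * (y₂ - b + 5) ^ 2) * (p⁻¹ / (s + t)) *
          (heat (s + t) (r - u) * ((√p)⁻¹ * Λ)) := by
          have hE := hΛ y hyI.2
          gcongr
      _ = B * heat (s + t) (r - u) := by
          rw [hB]
          ring
  have hK : pathWeight (j + 1 + l) S r u
      ≤ ENNReal.ofReal (B * heat (s + t) (r - u) * (y₂ - y₁)) := by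
    rw [pathWeight_split, hsub]
    refine (setLIntegral_mono' measurableSet_Icc hpt).trans ?_
    rw [setLIntegral_const, Real.volume_Icc, ← ENNReal.ofReal_mul (by positivity)]
  have hy0 : 0 ≤ y₂ - y₁ := by linarith
  have h := ENNReal.toReal_le_of_le_ofReal (by positivity) hK
  rw [bridgeLaw_tube (j + 1 + l) hSm, hk, div_le_iff₀ hH]
  refine h.trans_eq ?_
  rw [hB]
  ring

theorem exp_neg_le_rpow {x β : ℝ} (hx : 0 < x) (hβ0 : 0 ≤ β) (hβ1 : β ≤ 1) :
    Real.exp (-x) ≤ x⁻¹ ^ β := by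
  rw [Real.inv_rpow hx.le, Real.exp_neg]
  refine inv_anti₀ (by positivity) ?_
  rcases le_total x 1 with h | h
  · exact (Real.rpow_le_one hx.le h hβ0).trans (Real.one_le_exp hx.le)
  · calc x ^ β ≤ x ^ (1 : ℝ) := Real.rpow_le_rpow_of_exponent_le h hβ1
      _ = x := Real.rpow_one x
      _ ≤ Real.exp x := by linarith [Real.add_one_le_exp x]

/-- Bound for the visits to a window within distance `m ^ σ` of the level `± a`, where `m` is the
distance in time to the nearer endpoint. Since the endpoints are at height at least
`ρ = a ^ (1 / σ)`, the window cannot be reached before times of order `ρ ^ 2`, which is where the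
factor `ρ ^ (-2 * β)` comes from; the decay in `m` is summable because `5 * σ < 1 / 2`. -/
theorem bridgeLaw_window_le_rpow {σ a r u b y₁ y₂ β : ℝ} (hσ0 : 0 < σ) (hσ1 : σ < 1 / 10)
    (hβ : β = (1 / 2 - 5 * σ) / 2) (ha : 5 ≤ a) (hr : a ^ (1 / σ) ≤ r) (hu : a ^ (1 / σ) ≤ u)
    (j l : ℕ) {m : ℕ} (hm : m = min (j + 1) (l + 1)) (hba : b ≤ a)
    (hab : -b ≤ a + (m : ℝ) ^ σ) (hby : b ≤ y₁) (hy : y₁ ≤ y₂) (hy₂ : y₂ ≤ a + (m : ℝ) ^ σ)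
    (hyy : y₂ - y₁ ≤ (m : ℝ) ^ σ) (hyb : y₂ - b ≤ (m : ℝ) ^ σ) :
    (bridgeLaw (j + 1 + l) r u).real
        {x | ∀ i : Fin (j + 1 + l), x i ∈ if i.val = j then Set.Icc y₁ y₂ else Set.Ici b}
      ≤ 97200 * (r * u / ((j : ℝ) + 1 + ((l : ℝ) + 1))) * (a ^ (1 / σ)) ^ (-(2 * β)) *
        (m : ℝ) ^ (-(1 + β)) := by
  have ha0 : 0 < a := by linarith
  have hβ0 : 0 < β := by rw [hβ]; linarith
  have hβ1 : β ≤ 1 := by rw [hβ]; linarith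
  set ρ := a ^ (1 / σ) with hρ
  have hρa : 4 * a ^ 2 ≤ ρ := by
    have h3 : (3 : ℝ) ≤ 1 / σ := by
      rw [le_div_iff₀ hσ0]
      linarith
    calc 4 * a ^ 2 ≤ a * a ^ 2 := by gcongr; linarith
      _ = a ^ (3 : ℝ) := by
        rw [show (3 : ℝ) = (3 : ℕ) by norm_num, Real.rpow_natCast]
        ring
      _ ≤ ρ := Real.rpow_le_rpow_of_exponent_le (by linarith) h3
  have haa : 5 * a ≤ a ^ 2 := by nlinarith
  have hρ0 : 0 < ρ := by linarith
  have hm1 : (1 : ℝ) ≤ m := by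
    have : 1 ≤ m := by omega
    exact_mod_cast this
  have hm0 : (0 : ℝ) < m := by linarith
  set M := (m : ℝ) ^ σ with hM
  have hM1 : 1 ≤ M := Real.one_le_rpow hm1 hσ0.le
  set s : ℝ := (j : ℝ) + 1 with hs_def
  set t : ℝ := (l : ℝ) + 1 with ht_def
  have hs : 0 < s := by positivity
  have ht : 0 < t := by positivity
  have hmst : (m : ℝ) = min s t := by
    rw [hm, hs_def, ht_def]
    push_cast
    rfl
  set p := s * t / (s + t) with hp
  have hp0 : 0 < p := by positivity
  have hpm : p ≤ m := by
    rw [hp, div_le_iff₀ (by positivity), hmst]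
    rcases le_total s t with h | h
    · rw [min_eq_left h]; nlinarith
    · rw [min_eq_right h]; nlinarith
  have hmp : (m : ℝ) / 2 ≤ p := by
    rw [hp, le_div_iff₀ (by positivity), hmst]
    rcases le_total s t with h | h
    · rw [min_eq_left h]; nlinarith
    · rw [min_eq_right h]; nlinarith
  have hΛ : ∀ y, y ≤ y₂ → Real.exp (-(y - (t * r + s * u) / (s + t)) ^ 2 / p)
      ≤ (4 * m / ρ ^ 2) ^ β := by
    intro y hyle
    have hle1 : Real.exp (-(y - (t * r + s * u) / (s + t)) ^ 2 / p) ≤ 1 := by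
      refine Real.exp_le_one_iff.2 ?_
      rw [neg_div, neg_nonpos]
      positivity
    rcases le_or_gt (ρ ^ 2) (4 * m) with h | h
    · refine hle1.trans (Real.one_le_rpow ?_ hβ0.le)
      rwa [one_le_div (by positivity)]
    · -- before times of order `ρ ^ 2` the barrier is still below `ρ / 2`
      have hMa : M ≤ a ^ 2 := by
        calc M ≤ (ρ ^ 2) ^ σ := Real.rpow_le_rpow hm0.le (by linarith) hσ0.le
          _ = a ^ 2 := by
            rw [hρ, ← Real.rpow_natCast, ← Real.rpow_mul (by positivity),
              ← Real.rpow_mul ha0.le, ← Real.rpow_natCast]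
            congr 1
            field_simp
      have hmean : ρ ≤ (t * r + s * u) / (s + t) := by
        rw [le_div_iff₀ (by positivity)]
        have h1 := mul_le_mul_of_nonneg_left hr ht.le
        have h2 := mul_le_mul_of_nonneg_left hu hs.le
        linarith
      have hgap : ρ / 2 ≤ (t * r + s * u) / (s + t) - y := by linarith
      have hsq : (ρ / 2) ^ 2 ≤ ((t * r + s * u) / (s + t) - y) ^ 2 :=
        pow_le_pow_left₀ (by positivity) hgap 2
      have hx : 0 < ρ ^ 2 / (4 * m) := by positivity
      calc _ ≤ Real.exp (-(ρ ^ 2 / (4 * m))) := by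
            refine Real.exp_le_exp.2 ?_
            rw [neg_div, neg_le_neg_iff]
            calc ρ ^ 2 / (4 * m) = (ρ / 2) ^ 2 / m := by field_simp; norm_num
              _ ≤ ((t * r + s * u) / (s + t) - y) ^ 2 / p := by gcongr
              _ = _ := by congr 1; ring
        _ ≤ (ρ ^ 2 / (4 * m))⁻¹ ^ β := exp_neg_le_rpow hx hβ0.le hβ1
        _ = _ := by rw [inv_div]
  have hra : a + 5 ≤ r := by linarith
  have hua : a + 5 ≤ u := by linarith
  refine (bridgeLaw_window_le j l (by linarith) (by linarith) hby hy hp hΛ).trans ?_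
  have hend : ∀ v, a + 5 ≤ v → v - b + 5 ≤ 3 * v * M := by
    intro v hv
    have h1 : v ≤ v * M := le_mul_of_one_le_right (by linarith) hM1
    have h2 : M ≤ v * M := le_mul_of_one_le_left (by linarith) (by linarith)
    linarith
  have h1 := hend r hra
  have h2 := hend u hua
  have h3 : y₂ - b + 5 ≤ 6 * M := by linarith
  have hsq : (√p)⁻¹ ≤ (3 / 2) * (√m)⁻¹ := by
    rw [← div_eq_mul_inv, inv_le_comm₀ (by positivity) (by positivity), inv_div]
    refine Real.le_sqrt_of_sq_le ?_
    rw [div_pow, Real.sq_sqrt hm0.le, div_le_iff₀ (by norm_num)]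
    linarith
  have hpi : p⁻¹ ≤ 2 * (m : ℝ)⁻¹ := by
    rw [← div_eq_mul_inv, inv_le_comm₀ hp0 (by positivity), inv_div]
    exact hmp
  have hΛ4 : (4 * m / ρ ^ 2) ^ β ≤ 4 * ((m : ℝ) ^ β * ρ ^ (-(2 * β))) := by
    rw [Real.div_rpow (by positivity) (by positivity), Real.mul_rpow (by norm_num) hm0.le,
      Real.rpow_neg hρ0.le, Real.rpow_mul hρ0.le, Real.rpow_two, div_eq_mul_inv, mul_assoc]
    gcongr
    calc (4 : ℝ) ^ β ≤ 4 ^ (1 : ℝ) := Real.rpow_le_rpow_of_exponent_le (by norm_num) hβ1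
      _ = 4 := Real.rpow_one 4
  have hr5 : 0 ≤ r - b + 5 := by linarith
  have hu5 : 0 ≤ u - b + 5 := by linarith
  have hy5 : 0 ≤ y₂ - b + 5 := by linarith
  have hy0 : 0 ≤ y₂ - y₁ := by linarith
  have hr0 : 0 ≤ r := by linarith
  have hu0 : 0 ≤ u := by linarith
  have hexp : M ^ 5 * ((m : ℝ)⁻¹ * (√m)⁻¹) * (m : ℝ) ^ β = (m : ℝ) ^ (-(1 + β)) := by
    rw [hM, ← Real.rpow_natCast, ← Real.rpow_mul hm0.le, Real.sqrt_eq_rpow,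
      ← Real.rpow_neg hm0.le, ← Real.rpow_neg_one, ← Real.rpow_add hm0, ← Real.rpow_add hm0,
      ← Real.rpow_add hm0]
    congr 1
    rw [hβ]
    push_cast
    ring
  calc _ ≤ 25 * (3 * r * M * (3 * u * M) * (6 * M) ^ 2) * M *
        (2 * (m : ℝ)⁻¹ * (3 / 2 * (√m)⁻¹)) * (4 * ((m : ℝ) ^ β * ρ ^ (-(2 * β)))) / (s + t) := by
        gcongr
    _ = 97200 * (r * u / (s + t)) * ρ ^ (-(2 * β)) *
        (M ^ 5 * ((m : ℝ)⁻¹ * (√m)⁻¹) * (m : ℝ) ^ β) := by ring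
    _ = _ := by rw [hexp]

/-! ### Comparison of the moving barrier with constant levels -/

theorem sum_min_rpow_le {q : ℝ} (hq : 1 < q) (n : ℕ) :
    ∑ j : Fin n, ((min (j.val + 1) (n - j.val) : ℕ) : ℝ) ^ (-q)
      ≤ 2 * ∑' i : ℕ, ((i : ℝ) + 1) ^ (-q) := by
  have hsum : Summable fun i : ℕ => ((i : ℝ) + 1) ^ (-q) := by
    have h := (summable_nat_add_iff (f := fun i : ℕ => (i : ℝ) ^ (-q)) 1).2
      (Real.summable_nat_rpow.2 (by linarith))
    simpa using h
  have hle : ∑ i ∈ Finset.range n, ((i : ℝ) + 1) ^ (-q) ≤ ∑' i : ℕ, ((i : ℝ) + 1) ^ (-q) :=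
    hsum.sum_le_tsum _ fun i _ => by positivity
  calc _ = ∑ j ∈ Finset.range n, ((min (j + 1) (n - j) : ℕ) : ℝ) ^ (-q) :=
        Fin.sum_univ_eq_sum_range (fun j => ((min (j + 1) (n - j) : ℕ) : ℝ) ^ (-q)) n
    _ ≤ ∑ j ∈ Finset.range n, (((j : ℝ) + 1) ^ (-q) + (((n - 1 - j : ℕ) : ℝ) + 1) ^ (-q)) := by
        refine Finset.sum_le_sum fun j hj => ?_
        have hj' := Finset.mem_range.1 hj
        rcases le_total (j + 1) (n - j) with h | h
        · rw [min_eq_left h]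
          push_cast
          exact le_add_of_nonneg_right (by positivity)
        · rw [min_eq_right h, show n - j = n - 1 - j + 1 by omega, Nat.cast_succ]
          exact le_add_of_nonneg_left (by positivity)
    _ ≤ _ := by
        rw [Finset.sum_add_distrib,
          Finset.sum_range_reflect (fun i : ℕ => ((i : ℝ) + 1) ^ (-q)) n]
        linarith

/-- The event that the path visits, at its `j`-th intermediate time, the window `[y₁, y₂]`, and
stays above `b` at the other times. -/
def windowEvent (n : ℕ) (b y₁ y₂ : ℝ) (j : Fin n) : Set (Fin n → ℝ) :=
  {x | ∀ i : Fin n, x i ∈ if i.val = j.val then Set.Icc y₁ y₂ else Set.Ici b}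

/-- The windows at all times together have probability `o(r * u / (n + 1))` as `a → ∞`. -/
theorem sum_bridgeLaw_windowEvent_le {σ a r u β : ℝ} (hσ0 : 0 < σ) (hσ1 : σ < 1 / 10)
    (hβ : β = (1 / 2 - 5 * σ) / 2) (ha : 5 ≤ a) (hr : a ^ (1 / σ) ≤ r) (hu : a ^ (1 / σ) ≤ u)
    (n : ℕ) (b y₁ y₂ : Fin n → ℝ) {M : Fin n → ℝ}
    (hM : ∀ j, M j = ((min (j.val + 1) (n - j.val) : ℕ) : ℝ) ^ σ)
    (hba : ∀ j, b j ≤ a) (hab : ∀ j, -b j ≤ a + M j) (hby : ∀ j, b j ≤ y₁ j)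
    (hy : ∀ j, y₁ j ≤ y₂ j) (hy₂ : ∀ j, y₂ j ≤ a + M j) (hyy : ∀ j, y₂ j - y₁ j ≤ M j)
    (hyb : ∀ j, y₂ j - b j ≤ M j) :
    ∑ j, (bridgeLaw n r u).real (windowEvent n (b j) (y₁ j) (y₂ j) j)
      ≤ 194400 * (∑' i : ℕ, ((i : ℝ) + 1) ^ (-(1 + β))) * (a ^ (1 / σ)) ^ (-(2 * β)) *
        (r * u / (n + 1)) := by
  have hβ0 : 0 < β := by rw [hβ]; linarith
  have ha0 : 0 < a := by linarith
  have hρ0 : 0 < a ^ (1 / σ) := by positivity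
  have hr0 : 0 ≤ r := by linarith
  have hu0 : 0 ≤ u := by linarith
  have hone : ∀ j : Fin n, (bridgeLaw n r u).real (windowEvent n (b j) (y₁ j) (y₂ j) j)
      ≤ 97200 * (r * u / (n + 1)) * (a ^ (1 / σ)) ^ (-(2 * β)) *
        ((min (j.val + 1) (n - j.val) : ℕ) : ℝ) ^ (-(1 + β)) := by
    rintro ⟨j, hj⟩
    obtain ⟨l, rfl⟩ : ∃ l, n = j + 1 + l := ⟨n - (j + 1), by omega⟩
    have hl : j + 1 + l - j = l + 1 := by omega
    have hMj := hM ⟨j, hj⟩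
    simp only [hl] at hMj ⊢
    have h := bridgeLaw_window_le_rpow hσ0 hσ1 hβ ha hr hu j l rfl (hba ⟨j, hj⟩)
      (hMj ▸ hab ⟨j, hj⟩) (hby ⟨j, hj⟩) (hy ⟨j, hj⟩) (hMj ▸ hy₂ ⟨j, hj⟩) (hMj ▸ hyy ⟨j, hj⟩)
      (hMj ▸ hyb ⟨j, hj⟩)
    refine h.trans_eq ?_
    have hk : ((j + 1 + l : ℕ) : ℝ) + 1 = (j : ℝ) + 1 + ((l : ℝ) + 1) := by
      push_cast
      ring
    rw [hk]
  refine (Finset.sum_le_sum fun j _ => hone j).trans ?_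
  rw [← Finset.mul_sum]
  refine (mul_le_mul_of_nonneg_left (sum_min_rpow_le (by linarith) n) (by positivity)).trans_eq ?_
  ring

theorem bridgeLaw_Ici_le_add {n : ℕ} {r u a : ℝ} {c : Fin n → ℝ} {γ : ℕ → ℝ}
    (hγ : ∀ i : Fin n, γ (i.val + 1) ≤ c i) :
    (bridgeLaw n r u).real {x | ∀ i : Fin n, x i ∈ Set.Ici a}
      ≤ (bridgeLaw n r u).real {x | ∀ i : Fin n, γ (i.val + 1) ≤ x i}
        + ∑ j, (bridgeLaw n r u).real (windowEvent n a a (c j) j) := by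
  have hsub : {x : Fin n → ℝ | ∀ i : Fin n, x i ∈ Set.Ici a}
      ⊆ {x | ∀ i : Fin n, γ (i.val + 1) ≤ x i} ∪ ⋃ j, windowEvent n a a (c j) j := by
    intro x hx
    by_cases h : ∀ i : Fin n, γ (i.val + 1) ≤ x i
    · exact Or.inl h
    push Not at h
    obtain ⟨j, hj⟩ := h
    refine Or.inr (Set.mem_iUnion.2 ⟨j, fun i => ?_⟩)
    by_cases hij : i.val = j.val
    · obtain rfl : i = j := Fin.ext hij
      rw [if_pos rfl]
      exact ⟨hx i, hj.le.trans (hγ i)⟩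
    · rw [if_neg hij]
      exact hx i
  refine (measureReal_mono hsub).trans ((measureReal_union_le _ _).trans ?_)
  gcongr
  exact measureReal_iUnion_fintype_le _

/-- A path above the barrier `-c` that goes below `-a` does so at the time `j` of its minimum, and
is then above the constant level `-c j`. -/
theorem bridgeLaw_le_Ici_add {n : ℕ} {r u a : ℝ} {c : Fin n → ℝ} {γ : ℕ → ℝ}
    (hγ : ∀ i : Fin n, -c i ≤ γ (i.val + 1)) :
    (bridgeLaw n r u).real {x | ∀ i : Fin n, γ (i.val + 1) ≤ x i}
      ≤ (bridgeLaw n r u).real {x | ∀ i : Fin n, x i ∈ Set.Ici (-a)}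
        + ∑ j, (bridgeLaw n r u).real (windowEvent n (-c j) (-c j) (-a) j) := by
  have hsub : {x : Fin n → ℝ | ∀ i : Fin n, γ (i.val + 1) ≤ x i}
      ⊆ {x | ∀ i : Fin n, x i ∈ Set.Ici (-a)} ∪ ⋃ j, windowEvent n (-c j) (-c j) (-a) j := by
    intro x hx
    by_cases h : ∀ i : Fin n, x i ∈ Set.Ici (-a)
    · exact Or.inl h
    push Not at h
    obtain ⟨j₀, hj₀⟩ := h
    have : Nonempty (Fin n) := ⟨j₀⟩
    obtain ⟨j, hj⟩ := Finite.exists_min x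
    have hja : x j ≤ -a := (hj j₀).trans (not_le.1 hj₀).le
    have hjc : -c j ≤ x j := (hγ j).trans (hx j)
    refine Or.inr (Set.mem_iUnion.2 ⟨j, fun i => ?_⟩)
    by_cases hij : i.val = j.val
    · obtain rfl : i = j := Fin.ext hij
      rw [if_pos rfl]
      exact ⟨hjc, hja⟩
    · rw [if_neg hij]
      exact hjc.trans (hj i)
  refine (measureReal_mono hsub).trans ((measureReal_union_le _ _).trans ?_)
  gcongr
  exact measureReal_iUnion_fintype_le _

/-- The constant level `a` costs a factor close to `1`, provided that `a ^ 2 ≤ r, u`; the second-order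
term of the exponential is controlled by `κ`. -/
theorem le_constant_level_prob {a r u k κ : ℝ} (ha : 5 ≤ a) (hr : a ^ 2 ≤ r) (hu : a ^ 2 ≤ u)
    (hk : 0 < k) (hκ : r * u / k ≤ κ) :
    4 * (r * u / k) * (1 - 2 / a - 4 * κ) ≤ 1 - Real.exp (-(4 * (r - a) * (u - a) / k)) := by
  have ha0 : 0 < a := by linarith
  have hra : a < r := by nlinarith
  have hua : a < u := by nlinarith
  have hr0 : 0 < r := by linarith
  have hu0 : 0 < u := by linarith
  set x := 4 * (r - a) * (u - a) / k with hx
  have hx0 : 0 ≤ x := by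
    have h1 : 0 ≤ r - a := by linarith
    have h2 : 0 ≤ u - a := by linarith
    positivity
  set y := r * u / k with hy
  have hy0 : 0 ≤ y := by positivity
  have hxy : x ≤ 4 * y := by
    rw [hx, hy, ← mul_div_assoc, mul_assoc]
    have h1 : 0 ≤ u - a := by linarith
    gcongr <;> linarith
  have hyx : 4 * y * (1 - 2 / a) ≤ x := by
    have h1 : 4 * y * (1 - 2 / a) = 4 * (r * u * (1 - 2 / a)) / k := by rw [hy]; ring
    rw [h1, hx, mul_assoc 4 (r - a)]
    have h2 : a * r ≤ r * u / a := by
      rw [le_div_iff₀ ha0]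
      nlinarith
    have h3 : a * u ≤ r * u / a := by
      rw [le_div_iff₀ ha0]
      nlinarith
    have h4 : r * u * (1 - 2 / a) = r * u - 2 * (r * u / a) := by ring
    have h5 : r * u * (1 - 2 / a) ≤ (r - a) * (u - a) := by
      rw [h4]
      linarith [sq_nonneg a]
    gcongr
  have he : x * (1 - x) ≤ 1 - Real.exp (-x) := by
    have h1 : Real.exp (-x) * (1 + x) ≤ 1 := by
      have h2 : 1 + x ≤ Real.exp x := by linarith [Real.add_one_le_exp x]
      calc _ ≤ Real.exp (-x) * Real.exp x := by gcongr
        _ = 1 := by rw [← Real.exp_add]; simp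
    have h3 : Real.exp (-x) ≤ 1 / (1 + x) := (le_div_iff₀ (by linarith)).2 h1
    have h4 : 1 / (1 + x) ≤ 1 - x + x ^ 2 := by
      rw [div_le_iff₀ (by linarith)]
      nlinarith [pow_nonneg hx0 3]
    linarith
  have hx2 : x * x ≤ 4 * y * (4 * κ) := mul_le_mul hxy (by linarith) hx0 (by linarith)
  calc _ = 4 * y * (1 - 2 / a) - 4 * y * (4 * κ) := by ring
    _ ≤ x - x * x := by linarith
    _ = x * (1 - x) := by ring
    _ ≤ _ := he

/-- The upper bound at the constant level `-a` is used with reflection level `-a - a`, the overshoot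
parameter `s = a` making the prefactor close to `1`. -/
theorem constant_level_prob_le {a r u k : ℝ} (ha : 5 ≤ a) (hr : a ^ 2 ≤ r) (hu : a ^ 2 ≤ u)
    (hk : 0 < k) :
    (1 - Real.exp (-(2 * a)))⁻¹ * (1 - Real.exp (-(4 * (r - (-a - a)) * (u - (-a - a)) / k)))
      ≤ 4 * (r * u / k) * (1 + 13 / a) := by
  have ha0 : 0 < a := by linarith
  have hr0 : 0 < r := by nlinarith
  have hu0 : 0 < u := by nlinarith
  set h := 1 / a with hh
  have hh0 : 0 < h := by positivity
  have hh1 : h ≤ 1 := by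
    rw [hh, div_le_one ha0]
    linarith
  have hah : a * h = 1 := by rw [hh]; field_simp
  have hA : (1 - Real.exp (-(2 * a)))⁻¹ ≤ 1 + h / 2 := by
    have h1 : 2 * a + 1 ≤ Real.exp (2 * a) := Real.add_one_le_exp _
    have h2 : Real.exp (-(2 * a)) ≤ (2 * a + 1)⁻¹ := by
      rw [Real.exp_neg]
      exact inv_anti₀ (by positivity) h1
    have h3 : 1 - (2 * a + 1)⁻¹ = 2 * a / (2 * a + 1) := by field_simp; ring
    calc _ ≤ (2 * a / (2 * a + 1))⁻¹ := by
          refine inv_anti₀ (by positivity) ?_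
          linarith
      _ = 1 + h / 2 := by rw [hh]; field_simp
  have hB : 1 - Real.exp (-(4 * (r - (-a - a)) * (u - (-a - a)) / k))
      ≤ 4 * (r - (-a - a)) * (u - (-a - a)) / k := by
    linarith [Real.one_sub_le_exp_neg (4 * (r - (-a - a)) * (u - (-a - a)) / k)]
  have hend : ∀ v, a ^ 2 ≤ v → v - (-a - a) ≤ v * (1 + 2 * h) := by
    intro v hv
    have h1 : a ^ 2 * h ≤ v * h := mul_le_mul_of_nonneg_right hv hh0.le
    have h2 : a ^ 2 * h = a := by rw [pow_two, mul_assoc, hah, mul_one]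
    linarith
  have hu' : 0 ≤ u - (-a - a) := by linarith
  have hr' : 0 ≤ r - (-a - a) := by linarith
  calc _ ≤ (1 + h / 2) * (4 * (r - (-a - a)) * (u - (-a - a)) / k) := by
        refine mul_le_mul hA hB ?_ (by positivity)
        refine sub_nonneg.2 (Real.exp_le_one_iff.2 ?_)
        rw [neg_nonpos]
        positivity
    _ ≤ (1 + h / 2) * (4 * (r * (1 + 2 * h)) * (u * (1 + 2 * h)) / k) := by
        gcongr
        · exact hend r hr
        · exact hend u hu
    _ = 4 * (r * u / k) * ((1 + h / 2) * (1 + 2 * h) ^ 2) := by ring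
    _ ≤ 4 * (r * u / k) * (1 + 13 * h) := by
        gcongr
        have h1 : h ^ 2 ≤ h := by nlinarith
        have h2 : h ^ 3 ≤ h := by nlinarith [pow_pos hh0 2]
        nlinarith
    _ = _ := by rw [hh]; ring

theorem tendsto_const_mul_rpow_neg {q : ℝ} (hq : 0 < q) (C : ℝ) :
    Filter.Tendsto (fun a : ℝ => C * a ^ (-q)) Filter.atTop (nhds 0) := by
  simpa using (tendsto_rpow_neg_atTop hq).const_mul C

theorem proposition6p1 (σ : ℝ) (hσ0 : 0 < σ) (hσ1 : σ < 1 / 10)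
    (ε : ℝ) (hε0 : 0 < ε) (hε1 : ε < 1) (δ : ℝ) (hδ0 : 0 < δ) (hδ1 : δ < 1) :
    ∃ a₀ : ℝ, 1 ≤ a₀ ∧
      ∀ a : ℝ, a₀ ≤ a → ∀ k : ℕ, 2 ≤ k → ∀ r u : ℝ,
        a ^ (1 / σ) ≤ r → a ^ (1 / σ) ≤ u → r * u ≤ (k : ℝ) ^ (1 - δ) →
        ∀ γ : ℕ → ℝ,
          (∀ i : ℕ, i ≤ k → |γ i| ≤ a + ((min i (k - i) : ℕ) : ℝ) ^ σ) →
          (1 - ε) * (4 * r * u / k)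
              ≤ (bridgeLaw (k - 1) r u).real {x | ∀ i : Fin (k - 1), γ (i.val + 1) ≤ x i} ∧
            (bridgeLaw (k - 1) r u).real {x | ∀ i : Fin (k - 1), γ (i.val + 1) ≤ x i}
              ≤ (1 + ε) * (4 * r * u / k) := by
  set β := (1 / 2 - 5 * σ) / 2 with hβ
  have hβ0 : 0 < β := by rw [hβ]; linarith
  set T := ∑' i : ℕ, ((i : ℝ) + 1) ^ (-(1 + β)) with hT
  have hT0 : 0 ≤ T := tsum_nonneg fun i => by positivity
  have hev : ∀ᶠ a : ℝ in Filter.atTop, 5 ≤ a ∧ 13 * a ^ (-(1 : ℝ)) < ε / 2 ∧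
      4 * a ^ (-δ) < ε / 4 ∧ 194400 * T * a ^ (-(2 * β)) < ε :=
    (Filter.eventually_ge_atTop 5).and
      (((tendsto_const_mul_rpow_neg one_pos 13).eventually_lt_const (by positivity)).and
        (((tendsto_const_mul_rpow_neg hδ0 4).eventually_lt_const (by positivity)).and
          ((tendsto_const_mul_rpow_neg (by positivity) _).eventually_lt_const hε0)))
  obtain ⟨a₀, ha₀⟩ := Filter.eventually_atTop.1 hev
  refine ⟨max 1 a₀, le_max_left _ _, fun a ha k hk r u hr hu hru γ hγ => ?_⟩
  obtain ⟨ha5, h13, hκ, hη⟩ := ha₀ a ((le_max_right _ _).trans ha)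
  have ha0 : 0 < a := by linarith
  rw [Real.rpow_neg_one, ← div_eq_mul_inv] at h13
  obtain ⟨n, rfl⟩ : ∃ n, k = n + 1 := ⟨k - 1, by omega⟩
  change (1 - ε) * (4 * r * u / (n + 1 : ℕ))
      ≤ (bridgeLaw n r u).real {x | ∀ i : Fin n, γ (i.val + 1) ≤ x i} ∧
    (bridgeLaw n r u).real {x | ∀ i : Fin n, γ (i.val + 1) ≤ x i}
      ≤ (1 + ε) * (4 * r * u / (n + 1 : ℕ))
  have hk0 : (0 : ℝ) < (n : ℝ) + 1 := by positivity
  have hk1 : (1 : ℝ) ≤ (n : ℝ) + 1 := by linarith [n.cast_nonneg (α := ℝ)]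
  rw [Nat.cast_succ] at hru ⊢
  have hσ10 : (2 : ℝ) ≤ 1 / σ := by
    rw [le_div_iff₀ hσ0]
    linarith
  have haρ : a ^ 2 ≤ a ^ (1 / σ) := by
    rw [← Real.rpow_two]
    exact Real.rpow_le_rpow_of_exponent_le (by linarith) hσ10
  have hr2 : a ^ 2 ≤ r := haρ.trans hr
  have hu2 : a ^ 2 ≤ u := haρ.trans hu
  have haa : a ≤ a ^ 2 := by nlinarith
  have hr1 : 1 ≤ r := by linarith
  have hu1 : 1 ≤ u := by linarith
  have hka : a ≤ (n : ℝ) + 1 := by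
    calc a ≤ r * 1 := by linarith
      _ ≤ r * u := by gcongr
      _ ≤ ((n : ℝ) + 1) ^ (1 - δ) := hru
      _ ≤ ((n : ℝ) + 1) ^ (1 : ℝ) := Real.rpow_le_rpow_of_exponent_le hk1 (by linarith)
      _ = _ := Real.rpow_one _
  have hsmall : r * u / (n + 1) ≤ a ^ (-δ) := by
    calc r * u / (n + 1) ≤ ((n : ℝ) + 1) ^ (1 - δ) / (n + 1) := by gcongr
      _ = ((n : ℝ) + 1) ^ (-δ) := by
        rw [sub_eq_add_neg, Real.rpow_add hk0, Real.rpow_one]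
        field_simp
      _ ≤ a ^ (-δ) := Real.rpow_le_rpow_of_nonpos ha0 hka (by linarith)
  set M : Fin n → ℝ := fun j => ((min (j.val + 1) (n - j.val) : ℕ) : ℝ) ^ σ with hM
  have hM0 : ∀ j, 0 ≤ M j := fun j => by positivity
  have hγM : ∀ j : Fin n, |γ (j.val + 1)| ≤ a + M j := by
    intro j
    have h := hγ (j.val + 1) (by omega)
    rwa [Nat.add_sub_add_right] at h
  set y := r * u / ((n : ℝ) + 1) with hy
  have hy0 : 0 ≤ y := by positivity
  have hη' : 194400 * T * (a ^ (1 / σ)) ^ (-(2 * β)) * y ≤ ε * y := by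
    refine mul_le_mul_of_nonneg_right (le_trans ?_ hη.le) hy0
    refine mul_le_mul_of_nonneg_left ?_ (by positivity)
    exact Real.rpow_le_rpow_of_nonpos ha0 (haa.trans haρ) (by linarith)
  have h4 : 4 * r * u / ((n : ℝ) + 1) = 4 * y := by rw [hy]; ring
  rw [h4]
  constructor
  · have hlow := le_constant_level_prob ha5 hr2 hu2 hk0 hsmall
    have hconst := le_bridgeLaw_Ici n (b := a) (r := r) (u := u) (by linarith) (by linarith)
    have hadd := bridgeLaw_Ici_le_add (r := r) (u := u) (c := fun j => a + M j) (γ := γ) (a := a)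
      (fun j => (le_abs_self _).trans (hγM j))
    have hdip := sum_bridgeLaw_windowEvent_le hσ0 hσ1 hβ ha5 hr hu n (fun _ => a) (fun _ => a)
      (fun j => a + M j) (M := M) (fun j => rfl) (fun j => le_rfl)
      (fun j => by linarith [hM0 j]) (fun j => le_rfl) (fun j => by linarith [hM0 j])
      (fun j => le_rfl) (fun j => by linarith) (fun j => by linarith)
    have h2a : 2 / a ≤ ε / 4 := by
      have : 2 / a = 2 / 13 * (13 / a) := by ring
      linarith
    have hfac : 4 * y * (1 - ε / 4 - ε / 4) ≤ 4 * y * (1 - 2 / a - 4 * a ^ (-δ)) :=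
      mul_le_mul_of_nonneg_left (by linarith) (by linarith)
    have hyε : 0 ≤ ε * y := by positivity
    linarith
  · have hup := constant_level_prob_le ha5 hr2 hu2 hk0
    have hconst := bridgeLaw_Ici_le n (b := -a) (r := r) (u := u) ha5 (by linarith) (by linarith)
    have hadd := bridgeLaw_le_Ici_add (r := r) (u := u) (c := fun j => a + M j) (γ := γ) (a := a)
      (fun j => neg_le_of_abs_le (hγM j))
    have hdip := sum_bridgeLaw_windowEvent_le hσ0 hσ1 hβ ha5 hr hu n (fun j => -(a + M j))
      (fun j => -(a + M j)) (fun _ => -a) (M := M) (fun j => rfl)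
      (fun j => by linarith [hM0 j]) (fun j => by linarith) (fun j => le_rfl)
      (fun j => by linarith [hM0 j]) (fun j => by linarith [hM0 j]) (fun j => by linarith)
      (fun j => by linarith)
    have hfac : 4 * y * (1 + 13 / a) ≤ 4 * y * (1 + ε / 2) :=
      mul_le_mul_of_nonneg_left (by linarith) (by linarith)
    have hyε : 0 ≤ ε * y := by positivity
    linarith
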